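/- **Multimonotone interpretation of $Z_{(2,m)}$.** For an integer partition $\lambda$ with rows $\lambda_1\ge\lambda_2\ge\cdots>0$, write $P_\lambda(\mathbf p)=\prod_i p_{\lambda_i}$ for the power sum function and $S_\lambda(\mathbf p)=\det\big(h_{\lambda_i-i+j}(\mathbf p)\big)_{1\le i,j\le \ell(\lambda)}$ for the Schur function, as polynomials in the power sums $\mathbf p=(p_1,p_2,\dots)$. Here $h_k=\sum_{|\mu|=k}P_\mu/Z_\mu$ ($h_k=0$ for $k<0$), and $Z_\mu=\prod_i m_i!\,i^{m_i}$ with $m_i$ the number of parts of $\mu$ equal to $i$. Let $m\ge 0$. For $s\in\mathbf C$ and $u_1,\dots,u_m\in\mathbf C\setminus\{0\}$ let $$Z_{(2,m)}(s,u_1,\dots,u_m\,|\,\mathbf p^{(1)},\mathbf p^{(2)})=\sum_\lambda r_\lambda^{(s,u)}\,S_\lambda(\mathbf p^{(1)})S_\lambda(\mathbf p^{(2)}),\qquad r_\lambda^{(s,u)}=s^{|\lambda|}\prod_{\alpha=1}^m\prod_{(i,j)\in\lambda}(u_\alpha+i-j),$$ the sum running over all integer partitions, as a formal power series in $\mathbf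 p^{(1)},\mathbf p^{(2)}$. For $q,w_1,\dots,w_m\in\mathbf C$ let $$\tilde Z_{(2,m)}(q,w\,|\,\mathbf p^{(1)},\mathbf p^{(2)})=\sum_\lambda \tilde r_\lambda^{(q,w)}\,S_\lambda(\mathbf p^{(1)})S_\lambda(\mathbf p^{(2)}),\qquad \tilde r_\lambda^{(q,w)}=q^{|\lambda|}\prod_{\alpha=1}^m\prod_{(i,j)\in\lambda}\big(1+w_\alpha(j-i)\big).$$ Both series converge coefficientwise, and the following hold. 1. (Reparametrization.) If $q=s\prod_{\alpha}u_\alpha$ and $w_\alpha=-1/u_\alpha$ with all $u_\alpha\neq0$, then $r_\lambda^{(s,u)}=\tilde r_\lambda^{(q,w)}$ for every $\lambda$, and hence $Z_{(2,m)}(s,u\,|\,\mathbf p^{(1)},\mathbf p^{(2)})=\tilde Z_{(2,m)}(q,w\,|\,\mathbf p^{(1)},\mathbf p^{(2)})$. 2. (Multimonotone paths.) For all $q,w_1,\dots,w_m\in\mathbf C$, with coefficientwise convergence, $$\tilde Z_{(2,m)}(q,w\,|\,\mathbf p^{(1)},\mathbf p^{(2)})=\sum_{n=0}^\infty q^n\sum_{|\lambda|=|\mu|=n}\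 \sum_{d_1,\dots,d_m=0}^\infty\Big(\prod_{\alpha=1}^m w_\alpha^{d_\alpha}\Big)E^{(n,d_1,\dots,d_m)}(\lambda,\mu)\,P_\lambda(\mathbf p^{(1)})P_\mu(\mathbf p^{(2)}),$$ where $n!\,E^{(n,d_1,\dots,d_m)}(\lambda,\mu)$ is the number of paths in the Cayley graph of $S_n$ generated by the transpositions, from an element $g$ of cycle type $\lambda$ to an element $h$ of cycle type $\mu$, of the form $h=(a_1b_1)\cdots(a_db_d)\,g$ with $d=\sum_\alpha d_\alpha$ and $a_i<b_i$, in which the $b_i$ are strictly increasing within each of the $m$ successive segments of lengths $d_1,\dots,d_m$, starting at $(a_1b_1)$. (All choices of $g$, $h$ and of the sequence of transpositions are counted.) 3. (Eigenvalues.) Let $\mathcal J_b=\sum_{a<b}(a\,b)\in\mathbf C[S_n]$ ($1\le b\le n$) be the Jucys–Murphy elements, let $E(w,\mathcal J)=\prod_{b=1}^n(1+w\mathcal J_b)$, and let $q^{P_0(\mathcal J)}$ act on $\mathbf C[S_n]$ as $q^n$. For $|\lambda|=n$ let $F_\lambda=\frac{\chi_\lambda(\mathrm{Id})}{n!}\sum_{g\in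 S_n}\chi_\lambda(\mathrm{cyc}(g))\,g$, where $\mathrm{cyc}(g)$ is the cycle type of $g$ and $\chi_\lambda$ is given by Frobenius' formula $S_\lambda=\sum_{|\mu|=n}\chi_\lambda(\mu)P_\mu/Z_\mu$. The $F_\lambda$ with $|\lambda|=n$ are nonzero, pairwise orthogonal, central idempotents with sum $1$, and for all $q,w_1,\dots,w_m\in\mathbf C$ $$q^{P_0(\mathcal J)}\prod_{\alpha=1}^mE(w_\alpha,\mathcal J)\,F_\lambda=\tilde r_\lambda^{(q,w)}F_\lambda .$$ -/

import Mathlib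

open scoped BigOperators
open scoped MvPowerSeries.WithPiTopology

noncomputable section

namespace Multimonotone

/-- The rows `λ₁ ≥ λ₂ ≥ ⋯ > 0` of an integer partition, as a list. -/
def rows {n : ℕ} (lam : n.Partition) : List ℕ := lam.parts.sort (· ≥ ·)

/-- The product `∏_{(i,j) ∈ λ} f (j - i)` over the contents of the boxes of the Young diagram of
`λ`. Rows and columns are numbered from `0` here, which does not change `j - i`. -/
def contentProd {n : ℕ} (lam : n.Partition) (f : ℤ → ℂ) : ℂ :=
  ∏ i : Fin (rows lam).length, ∏ j : Fin ((rows lam).get i), f ((j : ℤ) - (i : ℤ))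

/-- `Z_μ = ∏ᵢ mᵢ! i ^ mᵢ`, where `mᵢ` is the number of parts of `μ` equal to `i`. -/
def zFactor {n : ℕ} (mu : n.Partition) : ℕ :=
  ∏ i ∈ mu.parts.toFinset, (mu.parts.count i).factorial * i ^ mu.parts.count i

/-- The power sum function `P_μ = P_{μ₁} P_{μ₂} ⋯` as a polynomial in the power sums; the variable
`X k` stands for `P_k`, `k ≥ 1` (and `X 0` never occurs). -/
def powerSum {n : ℕ} (mu : n.Partition) : MvPolynomial ℕ ℂ :=
  (mu.parts.map MvPolynomial.X).prod

/-- The complete symmetric function `h_k = ∑_{|μ| = k} P_μ / Z_μ`, with `h_k = 0` for `k < 0`. -/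
def completeSymm (k : ℤ) : MvPolynomial ℕ ℂ :=
  if 0 ≤ k then ∑ mu : k.toNat.Partition, MvPolynomial.C (1 / (zFactor mu : ℂ)) * powerSum mu
  else 0

/-- The Schur function `S_λ = det (h_{λᵢ - i + j})`, `1 ≤ i, j ≤ ℓ(λ)`. -/
def schur {n : ℕ} (lam : n.Partition) : MvPolynomial ℕ ℂ :=
  Matrix.det (Matrix.of fun i j : Fin (rows lam).length =>
    completeSymm (((rows lam).get i : ℤ) - (i : ℤ) + (j : ℤ)))

/-- `f(p⁽¹⁾) g(p⁽²⁾)` as a formal power series in the two sequences of variables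
`p⁽¹⁾_k = X (Sum.inl k)` and `p⁽²⁾_k = X (Sum.inr k)`. -/
def twoSets (f g : MvPolynomial ℕ ℂ) : MvPowerSeries (ℕ ⊕ ℕ) ℂ :=
  ((MvPolynomial.rename Sum.inl f * MvPolynomial.rename Sum.inr g : MvPolynomial (ℕ ⊕ ℕ) ℂ) :
    MvPowerSeries (ℕ ⊕ ℕ) ℂ)

/-- `r_λ^{(s,u)} = s^{|λ|} ∏_α ∏_{(i,j) ∈ λ} (u_α + i - j)`. -/
def rCoeff {m n : ℕ} (s : ℂ) (u : Fin m → ℂ) (lam : n.Partition) : ℂ :=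
  s ^ n * ∏ α, contentProd lam fun c => u α - (c : ℂ)

/-- `r̃_λ^{(q,w)} = q^{|λ|} ∏_α ∏_{(i,j) ∈ λ} (1 + w_α (j - i))`. -/
def rTilde {m n : ℕ} (q : ℂ) (w : Fin m → ℂ) (lam : n.Partition) : ℂ :=
  q ^ n * ∏ α, contentProd lam fun c => 1 + w α * (c : ℂ)

/-- `Z_{(2,m)}(s, u | p⁽¹⁾, p⁽²⁾) = ∑_λ r_λ^{(s,u)} S_λ(p⁽¹⁾) S_λ(p⁽²⁾)`, the sum (coefficientwise in
`p⁽¹⁾, p⁽²⁾`) being over all integer partitions. -/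
def Z {m : ℕ} (s : ℂ) (u : Fin m → ℂ) : MvPowerSeries (ℕ ⊕ ℕ) ℂ :=
  ∑' l : (Σ n : ℕ, n.Partition), rCoeff s u l.2 • twoSets (schur l.2) (schur l.2)

/-- `Z̃_{(2,m)}(q, w | p⁽¹⁾, p⁽²⁾) = ∑_λ r̃_λ^{(q,w)} S_λ(p⁽¹⁾) S_λ(p⁽²⁾)`. -/
def ZTilde {m : ℕ} (q : ℂ) (w : Fin m → ℂ) : MvPowerSeries (ℕ ⊕ ℕ) ℂ :=
  ∑' l : (Σ n : ℕ, n.Partition), rTilde q w l.2 • twoSets (schur l.2) (schur l.2)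

/-- The cycle type of a permutation in `S_n`, fixed points included, as a partition of `n`. -/
def cyc {n : ℕ} (g : Equiv.Perm (Fin n)) : n.Partition where
  parts := g.partition.parts
  parts_pos := g.partition.parts_pos
  parts_sum := g.partition.parts_sum.trans (Fintype.card_fin n)

/-- A path in the Cayley graph of `S_n` generated by the transpositions, from an element `source` of
cycle type `λ` to an element `target` of cycle type `μ`, that consists of `m` successive segments of
lengths `d_α`: `target = (a₁ b₁) ⋯ (a_d b_d) source`, where `a < b` in every transposition and the
`b`'s strictly increase within each segment. The `i`-th transposition of the segment `α` is
`(a α i  b α i)`. -/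
@[ext]
structure MultimonotonePath {m n : ℕ} (d : Fin m → ℕ) (lam mu : n.Partition) where
  source : Equiv.Perm (Fin n)
  target : Equiv.Perm (Fin n)
  a : (α : Fin m) → Fin (d α) → Fin n
  b : (α : Fin m) → Fin (d α) → Fin n
  a_lt_b : ∀ α i, a α i < b α i
  strictMono_b : ∀ α, StrictMono (b α)
  cyc_source : cyc source = lam
  cyc_target : cyc target = mu
  target_eq : target =
    (List.ofFn fun α => (List.ofFn fun i => Equiv.swap (a α i) (b α i)).prod).prod * source

/-- `E^{(n, d₁, …, d_m)}(λ, μ)`: the number of multimonotone paths from the class `λ` to the class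
`μ`, divided by `n!`. -/
def E {m n : ℕ} (d : Fin m → ℕ) (lam mu : n.Partition) : ℂ :=
  (Nat.card (MultimonotonePath d lam mu) : ℂ) / (n.factorial : ℂ)

/-- The group algebra `ℂ[S_n]`. -/
abbrev GroupAlg (n : ℕ) : Type := MonoidAlgebra ℂ (Equiv.Perm (Fin n))

/-- The Jucys–Murphy element `𝒥_b = ∑_{a < b} (a b)`. -/
def jucysMurphy {n : ℕ} (b : Fin n) : GroupAlg n :=
  ∑ a ∈ Finset.univ.filter (· < b), MonoidAlgebra.single (Equiv.swap a b) 1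

/-- `E(w, 𝒥) = ∏_b (1 + w 𝒥_b)`. -/
def elemJM (n : ℕ) (w : ℂ) : GroupAlg n :=
  (List.ofFn fun b : Fin n => 1 + w • jucysMurphy b).prod

/-- The character value `χ_λ(μ)`, read off from Frobenius' formula
`S_λ = ∑_{|μ| = |λ|} χ_λ(μ) P_μ / Z_μ`. -/
def chi {n : ℕ} (lam mu : n.Partition) : ℂ :=
  (zFactor mu : ℂ) * (schur lam).coeff (Multiset.toFinsupp mu.parts)

/-- The idempotent `F_λ = (χ_λ(Id) / n!) ∑_g χ_λ(cyc g) g` of `ℂ[S_n]`. -/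
def idem {n : ℕ} (lam : n.Partition) : GroupAlg n :=
  ∑ g : Equiv.Perm (Fin n),
    MonoidAlgebra.single g (chi lam (cyc 1) / (n.factorial : ℂ) * chi lam (cyc g))

end Multimonotone

end

/-! The theorem comes from evaluating `∏_α E(w_α, 𝒥)` in `ℂ[S_n]` in two ways. Multiplying out the
Jucys–Murphy elements turns each factor into a sum over transposition sequences with strictly
increasing `b`'s (`elemJM_eq_sum_segmentSum`), so the product enumerates multimonotone paths.
Spectrally, each factor is central and acts on `F_λ` by a content product (`elemJM_mul_idem`). Since
the `F_λ` sum to `1`, applying the functional `classPairing` to both forms gives `sum_pow_mul_E`.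
Together with Frobenius' formula this is the degree `n` part of the path expansion. Convergence is a
finiteness statement: a monomial receives contributions from a single `n`, and `E` vanishes as soon
as some `d_α > n`.

The numbers `χ_λ(μ)` are only coefficients of Schur functions, so they have to be tied to
representations. Schur functions are orthonormal for the Hall inner product (`hall_schurList`),
which gives both orthogonality relations for `chi`. The Jacobi–Trudi determinant writes `S_λ` as a
signed sum of cycle indices of finite groups, and the pairing of a cycle index with the character of
a Wedderburn block is the dimension of a space of invariants. Hence a block character has integer
coordinates in the orthonormal family of the `χ_λ`. As its norm is one, it is `± χ_λ` for a single
`λ`. Every `λ` occurs (`exists_block_of_chi`), and the sign cancels in `F_λ`, which is therefore the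
central idempotent of a block.

For the eigenvalue, Jucys' formula (`elemJM_eq_sum`) reads `E(w, 𝒥) = ∑_g w ^ ℓ(g) g`, with `ℓ` the
transposition length. It shows centrality, and makes the eigenvalue a normalized value of `S_λ` at
`p_k = w ^ (k - 1)`. At that point the Jacobi–Trudi determinant factors into the content product
(`contentSpec_schur`). -/

noncomputable section

namespace Multimonotone

/-! ### Multiplicity factors, power sums and Newton's identity. -/

/-- The number `∏ᵢ mᵢ! i ^ mᵢ` attached to the multiplicities `mᵢ`. -/
def zMult (d : ℕ →₀ ℕ) : ℕ := d.prod fun i e => e.factorial * i ^ e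

theorem zMult_add_single (d : ℕ →₀ ℕ) (a : ℕ) :
    zMult (d + Finsupp.single a 1) = zMult d * (a * (d a + 1)) := by
  classical
  have h1 : zMult (d + Finsupp.single a 1) = ∏ i ∈ insert a d.support,
      ((d + Finsupp.single a 1 : ℕ →₀ ℕ) i).factorial * i ^ ((d + Finsupp.single a 1 : ℕ →₀ ℕ) i) := by
    refine Finsupp.prod_of_support_subset _ ?_ _ (by simp)
    intro i hi
    by_cases h : i = a
    · simp [h]
    · simp [Ne.symm h] at hi
      simp [hi]
  have h2 : zMult d = ∏ i ∈ insert a d.support, (d i).factorial * i ^ d i :=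
    Finsupp.prod_of_support_subset _ (Finset.subset_insert _ _) _ (by simp)
  rw [h1, h2, ← Finset.mul_prod_erase _ _ (Finset.mem_insert_self a _),
    ← Finset.mul_prod_erase _ (fun i => (d i).factorial * i ^ d i) (Finset.mem_insert_self a _)]
  rw [Finset.prod_congr rfl (g := fun i => (d i).factorial * i ^ d i)]
  · simp only [Finsupp.add_apply, Finsupp.single_eq_same, Nat.factorial_succ, pow_succ]
    ring
  · intro i hi
    have : a ≠ i := (Finset.ne_of_mem_erase hi).symm
    simp [this]

theorem zFactor_eq_zMult {n : ℕ} (mu : n.Partition) :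
    zFactor mu = zMult (Multiset.toFinsupp mu.parts) := by
  classical
  simp only [zFactor, zMult, Finsupp.prod, Multiset.toFinsupp_support, Multiset.toFinsupp_apply]

theorem zFactor_pos {n : ℕ} (mu : n.Partition) : 0 < zFactor mu := by
  refine Finset.prod_pos fun i hi => Nat.mul_pos (Nat.factorial_pos _) (pow_pos ?_ _)
  exact mu.parts_pos (Multiset.mem_toFinset.1 hi)

theorem zFactor_ne_zero {n : ℕ} (mu : n.Partition) : (zFactor mu : ℂ) ≠ 0 :=
  Nat.cast_ne_zero.2 (zFactor_pos mu).ne'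

theorem powerSum_eq_monomial {n : ℕ} (mu : n.Partition) :
    powerSum mu = MvPolynomial.monomial (Multiset.toFinsupp mu.parts) 1 := by
  have key : ∀ s : Multiset ℕ, (s.map MvPolynomial.X).prod =
      (MvPolynomial.monomial (Multiset.toFinsupp s) 1 : MvPolynomial ℕ ℂ) := by
    intro s
    induction s using Multiset.induction_on with
    | empty => simp
    | cons a s ih =>
      rw [Multiset.map_cons, Multiset.prod_cons, ih, MvPolynomial.X, MvPolynomial.monomial_mul,
        ← Multiset.singleton_add, map_add, Multiset.toFinsupp_singleton, one_mul]
  exact key _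

/-- The complete symmetric function `h_k` for a natural number `k`. -/
def hsym (k : ℕ) : MvPolynomial ℕ ℂ :=
  ∑ mu : k.Partition, MvPolynomial.C (1 / (zFactor mu : ℂ)) * powerSum mu

theorem completeSymm_natCast (k : ℕ) : completeSymm (k : ℤ) = hsym k := by
  rw [completeSymm, if_pos (Int.natCast_nonneg k)]
  rfl

theorem completeSymm_of_neg {k : ℤ} (hk : k < 0) : completeSymm k = 0 := by
  rw [completeSymm, if_neg (not_le.2 hk)]

theorem hsym_zero : hsym 0 = 1 := by
  simp [hsym, powerSum, zFactor]

theorem sum_count_mul {n : ℕ} (mu : n.Partition) :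
    ∑ j ∈ Finset.range n, (j + 1) * mu.parts.count (j + 1) = n := by
  classical
  have h1 : ∑ i ∈ mu.parts.toFinset, mu.parts.count i • i = n := by
    rw [← Finset.sum_multiset_count, mu.parts_sum]
  conv_rhs => rw [← h1]
  have h2 : ∑ j ∈ Finset.range n, (j + 1) * mu.parts.count (j + 1) =
      ∑ i ∈ Finset.Icc 1 n, i * mu.parts.count i := by
    rw [← Finset.sum_image (g := fun j => j + 1) (f := fun i => i * mu.parts.count i)
      (by intro a _ b _ h; exact Nat.succ_injective h)]
    refine Finset.sum_congr ?_ fun _ _ => rfl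
    ext i
    simp only [Finset.mem_image, Finset.mem_range, Finset.mem_Icc]
    constructor
    · rintro ⟨a, ha, rfl⟩; omega
    · rintro ⟨h1, h2⟩; exact ⟨i - 1, by omega, by omega⟩
  rw [h2]
  symm
  refine (Finset.sum_subset ?_ ?_).trans (Finset.sum_congr rfl fun i _ => ?_)
  · intro i hi
    rw [Multiset.mem_toFinset] at hi
    exact Finset.mem_Icc.2 ⟨mu.parts_pos hi, Nat.Partition.le_of_mem_parts hi⟩
  · intro i _ hi
    rw [Multiset.mem_toFinset] at hi
    simp [Multiset.count_eq_zero_of_notMem hi]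
  · simp [mul_comm]

/-- Newton's identity `k h_k = ∑_{j=1}^k p_j h_{k-j}`. -/
theorem newton_hsym (k : ℕ) : (k : MvPolynomial ℕ ℂ) * hsym k =
    ∑ j ∈ Finset.range k, MvPolynomial.X (j + 1) * hsym (k - (j + 1)) := by
  classical
  -- Each term is spread over all partitions of `k`: removing one part `j + 1` divides `Z_μ` by `(j
  -- + 1) m_{j+1}`, and partitions without such a part get weight `0`. Summing over `j`, the weights
  -- add up to `∑ i m_i = k`.
  have h1 : ∀ j ∈ Finset.range k, MvPolynomial.X (j + 1) * hsym (k - (j + 1)) =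
      ∑ mu : k.Partition, (((j + 1) * mu.parts.count (j + 1) : ℕ) : MvPolynomial ℕ ℂ) *
        (MvPolynomial.C (1 / (zFactor mu : ℂ)) * powerSum mu) := by
    intro j hj
    have hj1 : j + 1 ≤ k := Finset.mem_range.1 hj
    let e := Nat.Partition.partitionWithPartEquiv (n := k) (a := j + 1) (by omega) hj1
    rw [hsym, Finset.mul_sum, ← Equiv.sum_comp e]
    symm
    rw [← Finset.sum_subset (Finset.subset_univ
      (Finset.univ.filter fun mu : k.Partition => j + 1 ∈ mu.parts)),
      Finset.sum_subtype (p := fun mu : k.Partition => j + 1 ∈ mu.parts) _ (by simp)]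
    · refine Finset.sum_congr rfl fun mu _ => ?_
      have hp : (e mu).parts = mu.1.parts.erase (j + 1) :=
        Nat.Partition.partitionWithPartEquiv_apply_parts _ _ _
      have hc : mu.1.parts = (j + 1) ::ₘ (e mu).parts := by
        rw [hp, Multiset.cons_erase mu.2]
      have hP : powerSum mu.1 = MvPolynomial.X (j + 1) * powerSum (e mu) := by
        rw [powerSum, powerSum, hc, Multiset.map_cons, Multiset.prod_cons]
      have hz : zFactor mu.1 = zFactor (e mu) * ((j + 1) * mu.1.parts.count (j + 1)) := by
        rw [zFactor_eq_zMult, zFactor_eq_zMult, hc, ← Multiset.singleton_add, map_add,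
          Multiset.toFinsupp_singleton, add_comm, zMult_add_single, Multiset.toFinsupp_apply]
        simp [Multiset.count_cons_self, add_comm]
      have hne : (((j + 1) * mu.1.parts.count (j + 1) : ℕ) : ℂ) ≠ 0 := by
        have := zFactor_ne_zero mu.1
        rw [hz, Nat.cast_mul] at this
        exact right_ne_zero_of_mul this
      have hC : (((j + 1) * mu.1.parts.count (j + 1) : ℕ) : MvPolynomial ℕ ℂ) *
          MvPolynomial.C (1 / (zFactor mu.1 : ℂ)) = MvPolynomial.C (1 / (zFactor (e mu) : ℂ)) := by
        rw [hz]
        generalize (j + 1) * mu.1.parts.count (j + 1) = c at hne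
        rw [Nat.cast_mul, ← map_natCast (MvPolynomial.C : ℂ →+* MvPolynomial ℕ ℂ) c, ← map_mul]
        congr 1
        have := zFactor_ne_zero (e mu)
        field_simp
      rw [← mul_assoc, hC, hP]
      ring
    · intro mu _ hmu
      have : mu.parts.count (j + 1) = 0 := by
        simpa using hmu
      simp [this]
  rw [Finset.sum_congr rfl h1, Finset.sum_comm, hsym, Finset.mul_sum]
  refine Finset.sum_congr rfl fun mu _ => ?_
  rw [← Finset.sum_mul, ← Nat.cast_sum, sum_count_mul]

/-! ### The Hall inner product and the adjoint of multiplication by `h_m`. -/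

/-- The Hall inner product, for which the monomials in the power sums are orthogonal and
`⟨P_μ, P_μ⟩ = Z_μ`. -/
def hall : MvPolynomial ℕ ℂ →ₗ[ℂ] MvPolynomial ℕ ℂ →ₗ[ℂ] ℂ :=
  (MvPolynomial.basisMonomials ℕ ℂ).constr ℂ fun d => (zMult d : ℂ) • MvPolynomial.lcoeff ℂ d

theorem hall_monomial (d : ℕ →₀ ℕ) (c : ℂ) (g : MvPolynomial ℕ ℂ) :
    hall (MvPolynomial.monomial d c) g = c * ((zMult d : ℂ) * g.coeff d) := by
  have h1 : hall (MvPolynomial.monomial d 1) = (zMult d : ℂ) • MvPolynomial.lcoeff ℂ d := by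
    have := Module.Basis.constr_basis (MvPolynomial.basisMonomials ℕ ℂ) ℂ
      (fun d => (zMult d : ℂ) • MvPolynomial.lcoeff ℂ d) d
    rwa [MvPolynomial.coe_basisMonomials] at this
  have h2 : MvPolynomial.monomial d c = c • MvPolynomial.monomial d (1 : ℂ) := by
    rw [MvPolynomial.smul_monomial, smul_eq_mul, mul_one]
  rw [h2, map_smul, h1]
  simp [MvPolynomial.lcoeff]

theorem hall_comm (f g : MvPolynomial ℕ ℂ) : hall f g = hall g f := by
  induction f using MvPolynomial.induction_on' with
  | add p q hp hq => rw [map_add, map_add, LinearMap.add_apply, hp, hq]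
  | monomial a c =>
    induction g using MvPolynomial.induction_on' with
    | add p q hp hq => rw [map_add, map_add, LinearMap.add_apply, hp, hq]
    | monomial b e =>
      simp only [hall_monomial, MvPolynomial.coeff_monomial]
      by_cases h : a = b
      · simp only [h, if_true]
        ring
      · simp [h, Ne.symm h]

/-- On monomials this is the recursion `zMult_add_single`. No condition `k ≠ 0` is needed: the
factor `0 ^ e` in `zMult` makes the form degenerate in `X 0`, and both sides vanish. -/
theorem hall_X_mul (k : ℕ) (f g : MvPolynomial ℕ ℂ) :
    hall (MvPolynomial.X k * f) g = hall f ((k : ℂ) • MvPolynomial.pderiv k g) := by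
  induction f using MvPolynomial.induction_on' with
  | add p q hp hq => rw [mul_add, map_add, map_add, LinearMap.add_apply, LinearMap.add_apply, hp, hq]
  | monomial d c =>
    rw [mul_comm, MvPolynomial.X, MvPolynomial.monomial_mul, mul_one, hall_monomial, hall_monomial,
      MvPolynomial.coeff_smul, MvPolynomial.coeff_pderiv, zMult_add_single]
    push_cast
    simp only [smul_eq_mul]
    ring

/-- The algebra homomorphism `p_k ↦ p_k + Y ^ k`. -/
def shift : MvPolynomial ℕ ℂ →ₐ[ℂ] Polynomial (MvPolynomial ℕ ℂ) :=
  MvPolynomial.aeval fun k =>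
    -- Index `0` is exempt: `Y ^ 0 = 1` would alter the constant term and break `coeff_zero_shift`.
    Polynomial.C (MvPolynomial.X k) + if k = 0 then 0 else Polynomial.X ^ k

theorem shift_X_succ (k : ℕ) : shift (MvPolynomial.X (k + 1)) =
    Polynomial.C (MvPolynomial.X (k + 1)) + Polynomial.X ^ (k + 1) := by
  simp [shift]

theorem coeff_zero_shift (f : MvPolynomial ℕ ℂ) : (shift f).coeff 0 = f := by
  have : ((Polynomial.aeval (0 : MvPolynomial ℕ ℂ)).restrictScalars ℂ).comp shift =
      AlgHom.id ℂ (MvPolynomial ℕ ℂ) := by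
    refine MvPolynomial.algHom_ext fun k => ?_
    by_cases hk : k = 0
    · simp [shift, hk]
    · simp [shift, hk]
  have h := DFunLike.congr_fun this f
  rw [Polynomial.coeff_zero_eq_aeval_zero]
  simpa using h

/-- Chain rule `Y d/dY (shift f) = ∑_{k ≥ 1} Y ^ k shift (k ∂_k f)`, truncated after `k = N`; the
tail is divisible by `Y ^ (N + 1)`, which is enough to read the coefficient of `Y ^ N`. Both sides
obey the Leibniz rule along `shift`, so the variables decide. -/
theorem X_pow_dvd_shift_sub (N : ℕ) (f : MvPolynomial ℕ ℂ) :
    (Polynomial.X : Polynomial (MvPolynomial ℕ ℂ)) ^ (N + 1) ∣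
      Polynomial.X * Polynomial.derivative (shift f) -
      ∑ j ∈ Finset.range N, Polynomial.X ^ (j + 1) *
        shift (((j + 1 : ℕ) : ℂ) • MvPolynomial.pderiv (j + 1) f) := by
  induction f using MvPolynomial.induction_on with
  | C a => simp [shift, Polynomial.algebraMap_apply]
  | add p q hp hq =>
    convert dvd_add hp hq using 1
    simp only [map_add, smul_add, mul_add, Finset.sum_add_distrib]
    ring
  | mul_X p k hp =>
    have hX : (Polynomial.X : Polynomial (MvPolynomial ℕ ℂ)) ^ (N + 1) ∣
      Polynomial.X * Polynomial.derivative (shift (MvPolynomial.X k)) -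
      ∑ j ∈ Finset.range N, Polynomial.X ^ (j + 1) *
        shift (((j + 1 : ℕ) : ℂ) • MvPolynomial.pderiv (j + 1) (MvPolynomial.X k)) := by
      rcases k with _ | k
      · simp [shift, MvPolynomial.pderiv_X]
      · rw [shift_X_succ]
        have h1 : ∀ j ∈ Finset.range N, (Polynomial.X : Polynomial (MvPolynomial ℕ ℂ)) ^ (j + 1) *
            shift (((j + 1 : ℕ) : ℂ) • MvPolynomial.pderiv (j + 1) (MvPolynomial.X (k + 1))) =
            if j = k then ((k + 1 : ℕ) : Polynomial (MvPolynomial ℕ ℂ)) * Polynomial.X ^ (k + 1)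
            else 0 := by
          intro j _
          split_ifs with h
          · subst h
            rw [MvPolynomial.pderiv_X_self, map_smul, map_one, Algebra.smul_def, map_natCast]
            ring
          · rw [MvPolynomial.pderiv_X_of_ne (by omega)]
            simp
        rw [Finset.sum_congr rfl h1, Finset.sum_ite_eq']
        simp only [Polynomial.derivative_add, Polynomial.derivative_C, Polynomial.derivative_X_pow,
          zero_add, Finset.mem_range]
        have h2 : Polynomial.X * (Polynomial.C ((k + 1 : ℕ) : MvPolynomial ℕ ℂ) *
            Polynomial.X ^ (k + 1 - 1)) =
            ((k + 1 : ℕ) : Polynomial (MvPolynomial ℕ ℂ)) * Polynomial.X ^ (k + 1) := by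
          rw [Nat.add_sub_cancel, map_natCast]
          ring
        rw [h2]
        split_ifs with h
        · simp
        · rw [sub_zero]
          exact Dvd.dvd.mul_left (pow_dvd_pow _ (by omega)) _
    convert dvd_add (hp.mul_left (shift (MvPolynomial.X k))) (hX.mul_left (shift p)) using 1
    have h3 : ∀ j ∈ Finset.range N, (Polynomial.X : Polynomial (MvPolynomial ℕ ℂ)) ^ (j + 1) *
        shift (((j + 1 : ℕ) : ℂ) • MvPolynomial.pderiv (j + 1) (p * MvPolynomial.X k)) =
        shift (MvPolynomial.X k) * (Polynomial.X ^ (j + 1) *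
          shift (((j + 1 : ℕ) : ℂ) • MvPolynomial.pderiv (j + 1) p)) +
        shift p * (Polynomial.X ^ (j + 1) *
          shift (((j + 1 : ℕ) : ℂ) • MvPolynomial.pderiv (j + 1) (MvPolynomial.X k))) := by
      intro j _
      rw [MvPolynomial.pderiv_mul]
      simp only [map_add, map_mul, Algebra.smul_def]
      ring
    rw [Finset.sum_congr rfl h3, Finset.sum_add_distrib, ← Finset.mul_sum, ← Finset.mul_sum,
      map_mul, Polynomial.derivative_mul]
    ring

theorem mul_coeff_shift (m : ℕ) (f : MvPolynomial ℕ ℂ) :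
    (m : MvPolynomial ℕ ℂ) * (shift f).coeff m = ∑ j ∈ Finset.range m,
      (shift (((j + 1 : ℕ) : ℂ) • MvPolynomial.pderiv (j + 1) f)).coeff (m - (j + 1)) := by
  have h := X_pow_dvd_shift_sub m f
  rw [Polynomial.X_pow_dvd_iff] at h
  have h1 := h m (Nat.lt_succ_self m)
  rw [Polynomial.coeff_sub, sub_eq_zero, Polynomial.finsetSum_coeff] at h1
  have h2 : (Polynomial.X * Polynomial.derivative (shift f)).coeff m =
      (m : MvPolynomial ℕ ℂ) * (shift f).coeff m := by
    rcases m with _ | m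
    · simp
    · rw [Polynomial.coeff_X_mul, Polynomial.coeff_derivative]
      push_cast
      ring
  rw [← h2, h1]
  refine Finset.sum_congr rfl fun j hj => ?_
  rw [Polynomial.coeff_X_pow_mul', if_pos (Nat.succ_le_of_lt (Finset.mem_range.1 hj))]

/-- Multiplication by `h_m` is adjoint to the `m`-th coefficient of `shift`. -/
theorem hall_hsym_mul (m : ℕ) (f g : MvPolynomial ℕ ℂ) :
    hall (hsym m * f) g = hall f ((shift g).coeff m) := by
  induction m using Nat.strong_induction_on generalizing f g with
  | _ m ih =>
    rcases Nat.eq_zero_or_pos m with rfl | hm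
    · rw [hsym_zero, one_mul, coeff_zero_shift]
    · have hm' : (m : ℂ) ≠ 0 := Nat.cast_ne_zero.2 hm.ne'
      have cast_mul : ∀ p : MvPolynomial ℕ ℂ, (m : MvPolynomial ℕ ℂ) * p = (m : ℂ) • p := by
        intro p
        rw [Algebra.smul_def, map_natCast]
      refine mul_left_cancel₀ hm' ?_
      have h1 : (m : ℂ) * hall (hsym m * f) g = hall ((m : MvPolynomial ℕ ℂ) * hsym m * f) g := by
        rw [mul_assoc, cast_mul, map_smul, LinearMap.smul_apply, smul_eq_mul]
      have h2 : (m : ℂ) * hall f ((shift g).coeff m) =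
          hall f ((m : MvPolynomial ℕ ℂ) * (shift g).coeff m) := by
        rw [cast_mul, map_smul, smul_eq_mul]
      -- Newton's identity for `h_m` and the recursion for the coefficients of `shift` have the same
      -- shape; `hall_X_mul` matches them term by term.
      rw [h1, h2, newton_hsym, mul_coeff_shift, Finset.sum_mul, map_sum, map_sum,
        LinearMap.sum_apply]
      refine Finset.sum_congr rfl fun j hj => ?_
      have hj' := Finset.mem_range.1 hj
      rw [mul_assoc, hall_X_mul, ih _ (by omega)]

/-- Adding `y ^ j` to the `j`-th power sum for all `j` divides the generating series of the complete
symmetric functions by `1 - y t`. -/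
theorem eq_add_mul_of_newton {R : Type*} [CommRing R] [IsDomain R] [CharZero R] {p a h : ℕ → R}
    {y : R} (ha0 : a 0 = 1) (hh0 : h 0 = 1)
    (ha : ∀ k : ℕ, (k : R) * a k = ∑ j ∈ Finset.range k, (p j + y ^ (j + 1)) * a (k - (j + 1)))
    (hh : ∀ k : ℕ, (k : R) * h k = ∑ j ∈ Finset.range k, p j * h (k - (j + 1))) (m : ℕ) :
    a (m + 1) = h (m + 1) + y * a m := by
  induction m using Nat.strong_induction_on with
  | _ m ih =>
    -- The induction hypothesis applies to `a (m - j)` for `j < m`; the last term has index `0` and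
    -- uses `a 0 = h 0`.
    have h1 : ∑ j ∈ Finset.range (m + 1), p j * a (m + 1 - (j + 1)) =
        ∑ j ∈ Finset.range (m + 1), p j * h (m + 1 - (j + 1)) +
        y * ∑ j ∈ Finset.range m, p j * a (m - (j + 1)) := by
      rw [Finset.sum_range_succ, Finset.sum_range_succ _ m, Finset.mul_sum, add_right_comm,
        ← Finset.sum_add_distrib]
      congr 1
      · refine Finset.sum_congr rfl fun j hj => ?_
        have hj' := Finset.mem_range.1 hj
        have : m + 1 - (j + 1) = (m - (j + 1)) + 1 := by omega
        rw [this, ih _ (by omega)]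
        ring
      · simp [ha0, hh0]
    have h2 : ∑ j ∈ Finset.range (m + 1), y ^ (j + 1) * a (m + 1 - (j + 1)) =
        y * a m + y * ∑ j ∈ Finset.range m, y ^ (j + 1) * a (m - (j + 1)) := by
      rw [Finset.sum_range_succ', Finset.mul_sum, add_comm]
      congr 1
      · simp
      · refine Finset.sum_congr rfl fun j _ => ?_
        have : m + 1 - (j + 1 + 1) = m - (j + 1) := by omega
        rw [this]
        ring
    have h3 := ha (m + 1)
    simp only [add_mul, Finset.sum_add_distrib] at h3
    rw [h1, h2, ← hh] at h3
    have h4 := ha m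
    simp only [add_mul, Finset.sum_add_distrib] at h4
    have hne : ((m + 1 : ℕ) : R) ≠ 0 := Nat.cast_ne_zero.2 (by omega)
    refine mul_left_cancel₀ hne ?_
    rw [h3]
    push_cast
    linear_combination (-y) * h4

theorem shift_hsym_succ (m : ℕ) : shift (hsym (m + 1)) =
    Polynomial.C (hsym (m + 1)) + Polynomial.X * shift (hsym m) := by
  refine eq_add_mul_of_newton (p := fun j => Polynomial.C (MvPolynomial.X (j + 1)))
    (a := fun k => shift (hsym k)) (h := fun k => Polynomial.C (hsym k))
    (by simp [hsym_zero]) (by simp [hsym_zero]) (fun k => ?_) (fun k => ?_) m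
  · have := congrArg shift (newton_hsym k)
    rw [map_mul, map_natCast, map_sum] at this
    rw [this]
    exact Finset.sum_congr rfl fun j _ => by rw [map_mul, shift_X_succ]
  · have := congrArg Polynomial.C (newton_hsym k)
    rw [map_mul, map_natCast, map_sum] at this
    rw [this]
    exact Finset.sum_congr rfl fun j _ => by rw [map_mul]

theorem shift_completeSymm (k : ℤ) : shift (completeSymm k) =
    Polynomial.C (completeSymm k) + Polynomial.X * shift (completeSymm (k - 1)) := by
  rcases lt_or_ge k 0 with hk | hk
  · rw [completeSymm_of_neg hk, completeSymm_of_neg (by omega)]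
    simp
  · obtain ⟨m, rfl⟩ := Int.eq_ofNat_of_zero_le hk
    rcases m with _ | m
    · rw [completeSymm_of_neg (show ((0 : ℕ) : ℤ) - 1 < 0 by simp), completeSymm_natCast, hsym_zero]
      simp
    · have : ((m + 1 : ℕ) : ℤ) - 1 = (m : ℤ) := by push_cast; ring
      rw [this, completeSymm_natCast, completeSymm_natCast, shift_hsym_succ]

theorem coeff_shift_completeSymm (k : ℤ) (s : ℕ) :
    (shift (completeSymm k)).coeff s = completeSymm (k - s) := by
  induction s generalizing k with
  | zero => simp [coeff_zero_shift]
  | succ s ih =>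
    rw [shift_completeSymm, Polynomial.coeff_add, Polynomial.coeff_C_succ, Polynomial.coeff_X_mul,
      ih, zero_add]
    congr 1
    push_cast
    ring

/-! ### Jacobi–Trudi determinants and orthonormality of Schur functions. -/

/-- The Jacobi–Trudi matrix of a list. -/
def jacobiTrudi (l : List ℕ) : Matrix (Fin l.length) (Fin l.length) (MvPolynomial ℕ ℂ) :=
  Matrix.of fun i j => completeSymm ((l.get i : ℤ) - (i : ℤ) + (j : ℤ))

/-- The Schur function of a list. -/
def schurList (l : List ℕ) : MvPolynomial ℕ ℂ := (jacobiTrudi l).det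

theorem schur_eq_schurList {n : ℕ} (lam : n.Partition) : schur lam = schurList (rows lam) := rfl

/-- By `shift_completeSymm`, subtracting `Y` times the preceding column removes `Y` from every
column but the first. Expansion along that column then isolates each power of `Y`. -/
theorem coeff_shift_det {r : ℕ} (alpha : Fin (r + 1) → ℤ) (k : ℕ) :
    (shift (Matrix.det (Matrix.of fun i j : Fin (r + 1) =>
      completeSymm (alpha i + (j : ℤ))))).coeff k =
    ∑ i : Fin (r + 1), (-1) ^ (i : ℕ) * completeSymm (alpha i - k) *
      ((Matrix.of fun i j : Fin (r + 1) => completeSymm (alpha i + (j : ℤ))).submatrix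
        i.succAbove Fin.succ).det := by
  set M : Matrix (Fin (r + 1)) (Fin (r + 1)) (MvPolynomial ℕ ℂ) :=
    Matrix.of fun i j : Fin (r + 1) => completeSymm (alpha i + (j : ℤ)) with hM
  have h1 : shift M.det = (M.map shift).det := AlgHom.map_det _ _
  have h2 : (M.map shift).det = (Matrix.of fun i j : Fin (r + 1) =>
      Fin.cases (shift (M i 0)) (fun j => Polynomial.C (M i j.succ)) j :
        Matrix (Fin (r + 1)) (Fin (r + 1)) (Polynomial (MvPolynomial ℕ ℂ))).det := by
    refine Matrix.det_eq_of_forall_col_eq_smul_add_pred (fun _ => Polynomial.X) ?_ ?_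
    · intro i
      simp
    · intro i j
      simp only [Matrix.map_apply, Matrix.of_apply, Fin.cases_succ, hM]
      rw [shift_completeSymm]
      congr 4
      simp only [Fin.val_succ, Fin.val_castSucc]
      push_cast
      ring
  rw [h1, h2, Matrix.det_succ_column_zero, Polynomial.finsetSum_coeff]
  refine Finset.sum_congr rfl fun i _ => ?_
  have h3 : ((Matrix.of fun i j : Fin (r + 1) =>
      Fin.cases (shift (M i 0)) (fun j => Polynomial.C (M i j.succ)) j :
        Matrix (Fin (r + 1)) (Fin (r + 1)) (Polynomial (MvPolynomial ℕ ℂ))).submatrix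
          i.succAbove Fin.succ).det = Polynomial.C ((M.submatrix i.succAbove Fin.succ).det) := by
    rw [RingHom.map_det]
    congr 1
  have h4 : (-1 : Polynomial (MvPolynomial ℕ ℂ)) ^ (i : ℕ) = Polynomial.C ((-1) ^ (i : ℕ)) := by
    simp
  rw [h3, h4, Polynomial.coeff_mul_C, Polynomial.coeff_C_mul, Matrix.of_apply, Fin.cases_zero, hM,
    Matrix.of_apply, coeff_shift_completeSymm]
  simp

theorem jacobiTrudi_cons_submatrix (a : ℕ) (l : List ℕ) :
    (jacobiTrudi (a :: l)).submatrix Fin.succ Fin.succ = jacobiTrudi l := by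
  ext1 i j
  simp only [jacobiTrudi, Matrix.submatrix_apply, Matrix.of_apply]
  congr 1
  simp only [List.length_cons, List.get_eq_getElem, Fin.val_succ, List.getElem_cons_succ]
  push_cast
  ring

/-- For `k ≥ a` the entries `h_{l_i - i - k}` of the lower rows have negative index and vanish,
while the top entry `h_{a - k}` is `1` or `0`. Thus `a` is the `Y`-degree, and the leading
coefficient drops the first row. -/
theorem coeff_shift_schurList_cons {a k : ℕ} {l : List ℕ} (hl : ∀ b ∈ l, b ≤ a) (hk : a ≤ k) :
    (shift (schurList (a :: l))).coeff k = if k = a then schurList l else 0 := by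
  have h1 := coeff_shift_det (r := l.length)
    (fun i : Fin (l.length + 1) => ((a :: l).get i : ℤ) - (i : ℤ)) k
  have h2 : schurList (a :: l) = Matrix.det (Matrix.of fun i j : Fin (l.length + 1) =>
      completeSymm (((a :: l).get i : ℤ) - (i : ℤ) + (j : ℤ))) := rfl
  rw [h2, h1, Fin.sum_univ_succ, Finset.sum_eq_zero, add_zero]
  · have h3 := jacobiTrudi_cons_submatrix a l
    have h4 : ((Matrix.of fun i j : Fin (l.length + 1) =>
      completeSymm (((a :: l).get i : ℤ) - (i : ℤ) + (j : ℤ))).submatrix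
        (Fin.succAbove 0) Fin.succ).det = schurList l := by
      rw [schurList, ← h3]
      rfl
    rw [h4]
    split_ifs with h
    · subst h
      have h5 : completeSymm 0 = 1 := (completeSymm_natCast 0).trans hsym_zero
      simp [h5]
    · have h5 : completeSymm ((a : ℤ) - (k : ℕ)) = 0 := completeSymm_of_neg (by omega)
      simp [h5]
  · intro i _
    have h6 : l.get i ≤ a := hl _ (List.get_mem _ _)
    rw [completeSymm_of_neg, mul_zero, zero_mul]
    have h7 : (a :: l).get i.succ = l.get i := rfl
    rw [h7]
    simp only [Fin.val_succ]
    push_cast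
    omega

/-- The first row of the determinant is `h_b, h_{b+1}, …`; moving these factors to the other side by
adjointness leaves only `h_b`, as the higher coefficients of `shift f` are zero. -/
theorem hall_schurList_cons (f : MvPolynomial ℕ ℂ) (b : ℕ) (m : List ℕ)
    (hf : ∀ k, b < k → (shift f).coeff k = 0) :
    hall f (schurList (b :: m)) = hall ((shift f).coeff b) (schurList m) := by
  have h1 : schurList (b :: m) = ∑ j : Fin (m.length + 1), (-1) ^ (j : ℕ) *
      hsym (b + j) * ((jacobiTrudi (b :: m)).submatrix Fin.succ j.succAbove).det := by
    rw [schurList]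
    refine (Matrix.det_succ_row_zero (n := m.length) (jacobiTrudi (b :: m))).trans ?_
    refine Finset.sum_congr rfl fun j _ => ?_
    congr 2
  have h2 : ∀ (j : ℕ) (k : ℕ) (g : MvPolynomial ℕ ℂ), hall f ((-1) ^ j * hsym k * g) =
      (-1) ^ j * hall ((shift f).coeff k) g := by
    intro j k g
    have : ((-1) ^ j * hsym k * g : MvPolynomial ℕ ℂ) = ((-1 : ℂ) ^ j) • (hsym k * g) := by
      rw [Algebra.smul_def]
      simp [mul_assoc]
    rw [this, map_smul, hall_comm, hall_hsym_mul, hall_comm, smul_eq_mul]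
  rw [h1, map_sum, Fin.sum_univ_succ, Finset.sum_eq_zero, add_zero]
  · rw [h2]
    have : ((jacobiTrudi (b :: m)).submatrix Fin.succ (Fin.succAbove 0)).det = schurList m := by
      rw [schurList, ← jacobiTrudi_cons_submatrix b m]
      rfl
    rw [this]
    simp
  · intro j _
    rw [h2, hf _ (by simp), map_zero, LinearMap.zero_apply, mul_zero]

theorem schurList_nil : schurList [] = 1 :=
  Matrix.det_fin_zero

theorem hall_one_one : hall 1 1 = 1 := by
  rw [← MvPolynomial.C_1, ← MvPolynomial.monomial_zero', hall_monomial]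
  simp [zMult]

theorem hall_nil_cons {b : ℕ} (hb : 0 < b) (m : List ℕ) :
    hall (schurList []) (schurList (b :: m)) = 0 := by
  have h : ∀ k, 0 < k → (shift (schurList [])).coeff k = 0 := by
    intro k hk
    rw [schurList_nil, map_one, Polynomial.coeff_one, if_neg hk.ne']
  rw [hall_schurList_cons _ _ _ fun k hk => h k (hb.trans hk), h b hb, map_zero,
    LinearMap.zero_apply]

theorem hall_cons_cons_of_le {a b : ℕ} {l m : List ℕ} (hl : ∀ c ∈ l, c ≤ a) (hab : a ≤ b) :
    hall (schurList (a :: l)) (schurList (b :: m)) =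
      if a = b then hall (schurList l) (schurList m) else 0 := by
  rw [hall_schurList_cons, coeff_shift_schurList_cons hl hab]
  · by_cases h : a = b
    · simp [h]
    · simp [h, Ne.symm h]
  · intro k hk
    rw [coeff_shift_schurList_cons hl (by omega), if_neg (by omega)]

/-- Schur functions are orthonormal for the Hall inner product. -/
theorem hall_schurList (l m : List ℕ) (hl : l.Pairwise (· ≥ ·)) (hm : m.Pairwise (· ≥ ·))
    (hl0 : ∀ a ∈ l, 0 < a) (hm0 : ∀ a ∈ m, 0 < a) :
    hall (schurList l) (schurList m) = if l = m then 1 else 0 := by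
  induction l generalizing m with
  | nil =>
    rcases m with _ | ⟨b, m⟩
    · rw [schurList_nil, hall_one_one, if_pos rfl]
    · rw [hall_nil_cons (hm0 b (by simp)), if_neg (by simp)]
  | cons a l ih =>
    rcases m with _ | ⟨b, m⟩
    · rw [hall_comm, hall_nil_cons (hl0 a (by simp)), if_neg (by simp)]
    · rw [List.pairwise_cons] at hl hm
      -- By symmetry of the form, the list with the larger first row may be the one that gets
      -- expanded.
      have key : hall (schurList (a :: l)) (schurList (b :: m)) =
          if a = b then hall (schurList l) (schurList m) else 0 := by
        rcases le_total a b with h | h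
        · exact hall_cons_cons_of_le hl.1 h
        · rw [hall_comm, hall_cons_cons_of_le hm.1 h, hall_comm]
          simp only [eq_comm]
      rw [key, ih m hl.2 hm.2 (fun c hc => hl0 c (by simp [hc])) fun c hc => hm0 c (by simp [hc])]
      by_cases h : a = b
      · simp [h]
      · simp [h]

theorem rows_pos {n : ℕ} (lam : n.Partition) : ∀ a ∈ rows lam, 0 < a := by
  intro a ha
  rw [rows, Multiset.mem_sort] at ha
  exact lam.parts_pos ha

theorem rows_pairwise {n : ℕ} (lam : n.Partition) : (rows lam).Pairwise (· ≥ ·) :=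
  Multiset.pairwise_sort _ _

theorem coe_rows {n : ℕ} (lam : n.Partition) : (rows lam : Multiset ℕ) = lam.parts :=
  Multiset.sort_eq _ _

theorem rows_injective {n : ℕ} : Function.Injective (rows (n := n)) := by
  intro lam nu h
  ext1
  rw [← coe_rows, h, coe_rows]

theorem sum_rows {n : ℕ} (lam : n.Partition) : (rows lam).sum = n := by
  rw [← Multiset.sum_coe, coe_rows, lam.parts_sum]

theorem hall_schur {n : ℕ} (lam nu : n.Partition) :
    hall (schur lam) (schur nu) = if lam = nu then 1 else 0 := by
  rw [schur_eq_schurList, schur_eq_schurList, hall_schurList _ _ (rows_pairwise _)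
    (rows_pairwise _) (rows_pos _) (rows_pos _)]
  simp only [rows_injective.eq_iff]

/-! ### Cycle types and sizes of conjugacy classes. -/

theorem cyc_parts {n : ℕ} (g : Equiv.Perm (Fin n)) :
    (cyc g).parts = g.cycleType + Multiset.replicate (n - g.cycleType.sum) 1 := by
  have : (cyc g).parts = g.partition.parts := rfl
  rw [this, Equiv.Perm.parts_partition, Equiv.Perm.sum_cycleType, Fintype.card_fin]

theorem cyc_eq_iff_isConj {n : ℕ} {g h : Equiv.Perm (Fin n)} : cyc g = cyc h ↔ IsConj g h := by
  rw [Equiv.Perm.partition_eq_of_isConj, Nat.Partition.ext_iff, Nat.Partition.ext_iff]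
  rfl

theorem cyc_inv {n : ℕ} (g : Equiv.Perm (Fin n)) : cyc g⁻¹ = cyc g := by
  ext1
  rw [cyc_parts, cyc_parts, Equiv.Perm.cycleType_inv]

theorem cyc_mul_comm {n : ℕ} (g h : Equiv.Perm (Fin n)) : cyc (g * h) = cyc (h * g) := by
  rw [cyc_eq_iff_isConj, isConj_iff]
  exact ⟨h, by group⟩

theorem parts_eq_filter_add_replicate {n : ℕ} (mu : n.Partition) :
    mu.parts = mu.parts.filter (2 ≤ ·) +
      Multiset.replicate (n - (mu.parts.filter (2 ≤ ·)).sum) 1 := by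
  have h1 := Multiset.filter_add_not (2 ≤ ·) mu.parts
  have h2 : mu.parts.filter (fun i => ¬ 2 ≤ i) =
      Multiset.replicate (mu.parts.filter (fun i => ¬ 2 ≤ i)).card 1 := by
    rw [Multiset.eq_replicate]
    refine ⟨rfl, fun b hb => ?_⟩
    rw [Multiset.mem_filter] at hb
    have := mu.parts_pos hb.1
    omega
  have h3 : (mu.parts.filter (2 ≤ ·)).sum + (mu.parts.filter (fun i => ¬ 2 ≤ i)).card = n := by
    have := congrArg Multiset.sum h1
    rw [mu.parts_sum, h2, Multiset.sum_add, Multiset.sum_replicate] at this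
    simpa using this
  conv_lhs => rw [← h1, h2]
  congr 2
  omega

theorem cyc_eq_iff_cycleType {n : ℕ} (g : Equiv.Perm (Fin n)) (mu : n.Partition) :
    cyc g = mu ↔ g.cycleType = mu.parts.filter (2 ≤ ·) := by
  constructor
  · rintro rfl
    exact Equiv.Perm.filter_parts_partition_eq_cycleType.symm
  · intro h
    ext1
    rw [cyc_parts, h, ← parts_eq_filter_add_replicate]

/-- `cycleType` omits fixed points; restoring the parts `1` accounts for the factor `(n - m.sum)! =
m₁!` in the order of the centralizer. -/
theorem card_cyc_mul_zFactor {n : ℕ} (mu : n.Partition) :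
    (Finset.univ.filter fun g : Equiv.Perm (Fin n) => cyc g = mu).card * zFactor mu =
      n.factorial := by
  classical
  have h := Equiv.Perm.card_of_cycleType_mul_eq (Fin n) (mu.parts.filter (2 ≤ ·))
  have hsum : (mu.parts.filter (2 ≤ ·)).sum ≤ n := by
    have := congrArg Multiset.sum (parts_eq_filter_add_replicate mu)
    rw [mu.parts_sum, Multiset.sum_add] at this
    omega
  rw [if_pos ⟨by simpa using hsum, fun a ha => (Multiset.mem_filter.1 ha).2⟩,
    Fintype.card_fin] at h
  simp only [cyc_eq_iff_cycleType]
  rw [← h]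
  congr 1
  set m := mu.parts.filter (2 ≤ ·) with hm
  have hcount1 : mu.parts.count 1 = n - m.sum := by
    conv_lhs => rw [parts_eq_filter_add_replicate mu]
    rw [Multiset.count_add, Multiset.count_replicate_self, Multiset.count_eq_zero_of_notMem, zero_add]
    simp
  have hcount : ∀ i, 2 ≤ i → mu.parts.count i = m.count i := by
    intro i hi
    rw [hm, Multiset.count_filter_of_pos hi]
  have h1 : (1 : ℕ) ∉ m.toFinset := by
    simp [hm]
  have hz : zFactor mu = ∏ i ∈ insert 1 m.toFinset,
      (mu.parts.count i).factorial * i ^ mu.parts.count i := by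
    refine Finset.prod_subset ?_ ?_
    · intro i hi
      rw [Multiset.mem_toFinset] at hi
      have := mu.parts_pos hi
      rw [Finset.mem_insert, Multiset.mem_toFinset, hm, Multiset.mem_filter]
      by_cases h : i = 1
      · exact Or.inl h
      · exact Or.inr ⟨hi, by omega⟩
    · intro i _ hi
      rw [Multiset.mem_toFinset] at hi
      simp [Multiset.count_eq_zero_of_notMem hi]
  rw [hz, Finset.prod_insert h1, hcount1, Finset.prod_multiset_count, one_pow, mul_one, mul_assoc,
    ← Finset.prod_mul_distrib]
  congr 1
  refine Finset.prod_congr rfl fun i hi => ?_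
  rw [hcount i, mul_comm]
  rw [Multiset.mem_toFinset, hm, Multiset.mem_filter] at hi
  exact hi.2

theorem card_cyc_eq {n : ℕ} (mu : n.Partition) :
    ((Finset.univ.filter fun g : Equiv.Perm (Fin n) => cyc g = mu).card : ℂ) =
      (n.factorial : ℂ) / zFactor mu := by
  rw [eq_div_iff (zFactor_ne_zero mu)]
  exact_mod_cast card_cyc_mul_zFactor mu

theorem sum_cyc {n : ℕ} {M : Type*} [AddCommGroup M] [Module ℂ M] (f : n.Partition → M) :
    ∑ g : Equiv.Perm (Fin n), f (cyc g) =
      ∑ mu : n.Partition, ((n.factorial : ℂ) / zFactor mu) • f mu := by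
  rw [← Finset.sum_fiberwise Finset.univ cyc]
  refine Finset.sum_congr rfl fun mu _ => ?_
  rw [← card_cyc_eq, Finset.sum_congr rfl (g := fun _ => f mu), Finset.sum_const,
    Nat.cast_smul_eq_nsmul]
  intro g hg
  rw [(Finset.mem_filter.1 hg).2]

/-! ### Schur functions as signed sums of cycle indices. -/

theorem cycleType_sumCongr {α β : Type*} [Fintype α] [DecidableEq α] [Fintype β] [DecidableEq β]
    (σ : Equiv.Perm α) (τ : Equiv.Perm β) :
    (Equiv.Perm.sumCongr σ τ).cycleType = σ.cycleType + τ.cycleType := by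
  classical
  have hl : ∀ σ : Equiv.Perm α, (Equiv.Perm.sumCongr σ (1 : Equiv.Perm β)) =
      σ.extendDomain (Equiv.ofInjective (Sum.inl : α → α ⊕ β) Sum.inl_injective) := by
    intro σ
    ext1 x
    rcases x with x | x
    · have := Equiv.Perm.extendDomain_apply_image σ
        (Equiv.ofInjective (Sum.inl : α → α ⊕ β) Sum.inl_injective) x
      rw [Equiv.ofInjective_apply, Equiv.ofInjective_apply] at this
      rw [this]
      rfl
    · rw [Equiv.Perm.extendDomain_apply_not_subtype _ _ (by simp)]
      rfl
  have hr : ∀ τ : Equiv.Perm β, (Equiv.Perm.sumCongr (1 : Equiv.Perm α) τ) =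
      τ.extendDomain (Equiv.ofInjective (Sum.inr : β → α ⊕ β) Sum.inr_injective) := by
    intro τ
    ext1 x
    rcases x with x | x
    · rw [Equiv.Perm.extendDomain_apply_not_subtype _ _ (by simp)]
      rfl
    · have := Equiv.Perm.extendDomain_apply_image τ
        (Equiv.ofInjective (Sum.inr : β → α ⊕ β) Sum.inr_injective) x
      rw [Equiv.ofInjective_apply, Equiv.ofInjective_apply] at this
      rw [this]
      rfl
  have hprod : Equiv.Perm.sumCongr σ τ =
      Equiv.Perm.sumCongr σ (1 : Equiv.Perm β) * Equiv.Perm.sumCongr (1 : Equiv.Perm α) τ := by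
    rw [Equiv.Perm.sumCongr_mul, mul_one, one_mul]
  rw [hprod, Equiv.Perm.Disjoint.cycleType_mul, hl, hr, Equiv.Perm.cycleType_extendDomain,
    Equiv.Perm.cycleType_extendDomain]
  rintro (x | x)
  · exact Or.inr rfl
  · exact Or.inl rfl

theorem cycleType_permCongr {α β : Type*} [Fintype α] [DecidableEq α] [Fintype β] [DecidableEq β]
    (e : α ≃ β) (σ : Equiv.Perm α) : (e.permCongr σ).cycleType = σ.cycleType := by
  classical
  have h : e.permCongr σ = σ.extendDomain (e.trans (Equiv.Set.univ β).symm) := by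
    ext1 x
    rw [Equiv.Perm.extendDomain_apply_subtype _ _ (Set.mem_univ x)]
    rfl
  rw [h, Equiv.Perm.cycleType_extendDomain]

/-- `f` is the average of `P_{cyc(ρ y)}` over a finite group `Y` acting on `n` points through `ρ`. -/
def IsPermAverage (n : ℕ) (f : MvPolynomial ℕ ℂ) : Prop :=
  ∃ (Y : Type) (_ : Group Y) (_ : Fintype Y) (ρ : Y →* Equiv.Perm (Fin n)),
    f = (1 / (Fintype.card Y : ℂ)) • ∑ y, powerSum (cyc (ρ y))

/-- `h_n` is the cycle index of `S_n` itself: a class of size `n! / Z_μ` has weight `1 / Z_μ`. -/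
theorem isPermAverage_hsym (n : ℕ) : IsPermAverage n (hsym n) := by
  refine ⟨Equiv.Perm (Fin n), inferInstance, inferInstance, MonoidHom.id _, ?_⟩
  have h := sum_cyc (n := n) (fun mu => powerSum mu)
  simp only [MonoidHom.id_apply]
  rw [h, Finset.smul_sum, hsym]
  refine Finset.sum_congr rfl fun mu _ => ?_
  have hn : (n.factorial : ℂ) ≠ 0 := Nat.cast_ne_zero.2 (Nat.factorial_pos n).ne'
  rw [smul_smul, Fintype.card_perm, Fintype.card_fin, MvPolynomial.smul_eq_C_mul]
  congr 2
  field_simp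

theorem powerSum_cyc_sum {a b : ℕ} (g : Equiv.Perm (Fin a)) (h : Equiv.Perm (Fin b)) :
    powerSum (cyc (finSumFinEquiv.permCongr (Equiv.Perm.sumCongr g h))) =
      powerSum (cyc g) * powerSum (cyc h) := by
  have hp : (cyc (finSumFinEquiv.permCongr (Equiv.Perm.sumCongr g h))).parts =
      (cyc g).parts + (cyc h).parts := by
    have hg : g.cycleType.sum ≤ a := by simpa using g.sum_cycleType_le
    have hh : h.cycleType.sum ≤ b := by simpa using h.sum_cycleType_le
    rw [cyc_parts, cyc_parts, cyc_parts, cycleType_permCongr, cycleType_sumCongr,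
      Multiset.sum_add, show a + b - (g.cycleType.sum + h.cycleType.sum) =
        (a - g.cycleType.sum) + (b - h.cycleType.sum) by omega, Multiset.replicate_add]
    abel
  rw [powerSum, powerSum, powerSum, hp, Multiset.map_add, Multiset.prod_add]

/-- The product group acts on the disjoint union of the two point sets, and cycle types add. -/
theorem IsPermAverage.mul {a b : ℕ} {f g : MvPolynomial ℕ ℂ} (hf : IsPermAverage a f)
    (hg : IsPermAverage b g) : IsPermAverage (a + b) (f * g) := by
  obtain ⟨Y, _, _, ρ, rfl⟩ := hf
  obtain ⟨W, _, _, τ, rfl⟩ := hg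
  refine ⟨Y × W, inferInstance, inferInstance,
    (finSumFinEquiv.permCongrHom.toMonoidHom.comp (Equiv.Perm.sumCongrHom (Fin a) (Fin b))).comp
      (ρ.prodMap τ), ?_⟩
  have h : ∀ x : Y × W, powerSum (cyc (((finSumFinEquiv.permCongrHom.toMonoidHom.comp
      (Equiv.Perm.sumCongrHom (Fin a) (Fin b))).comp (ρ.prodMap τ)) x)) =
      powerSum (cyc (ρ x.1)) * powerSum (cyc (τ x.2)) := fun x => powerSum_cyc_sum _ _
  rw [Finset.sum_congr rfl fun x _ => h x, Fintype.sum_prod_type, smul_mul_smul_comm,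
    Finset.sum_mul_sum, Fintype.card_prod]
  congr 1
  push_cast
  rw [div_mul_div_comm, one_mul]

theorem isPermAverage_one : IsPermAverage 0 1 := by
  rw [← hsym_zero]
  exact isPermAverage_hsym 0

theorem prod_completeSymm {ι : Type*} (s : Finset ι) (c : ι → ℤ) :
    ∏ i ∈ s, completeSymm (c i) = 0 ∨
      ∃ n : ℕ, (n : ℤ) = ∑ i ∈ s, c i ∧ IsPermAverage n (∏ i ∈ s, completeSymm (c i)) := by
  classical
  induction s using Finset.induction_on with
  | empty => exact Or.inr ⟨0, by simp, by simpa using isPermAverage_one⟩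
  | insert a s ha ih =>
    rw [Finset.prod_insert ha, Finset.sum_insert ha]
    rcases lt_or_ge (c a) 0 with h | h
    · left
      rw [completeSymm_of_neg h, zero_mul]
    · rcases ih with ih | ⟨n, hn, ih⟩
      · left
        rw [ih, mul_zero]
      · right
        obtain ⟨k, hk⟩ := Int.eq_ofNat_of_zero_le h
        refine ⟨k + n, by push_cast; rw [hk, hn], ?_⟩
        have h1 : completeSymm (c a) = hsym k := by rw [hk, completeSymm_natCast]
        rw [h1]
        exact (isPermAverage_hsym k).mul ih

/-- Leibniz expansion of the Jacobi–Trudi determinant. Permuting rows does not change the sum of the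
indices `λ_i - i + j`, so every nonzero term acts on exactly `n` points. The coefficients `±1` are
what later gives integrality. -/
theorem schur_eq_sum_isPermAverage {n : ℕ} (lam : n.Partition) :
    ∃ F : Equiv.Perm (Fin (rows lam).length) → MvPolynomial ℕ ℂ,
      (∀ σ, F σ = 0 ∨ IsPermAverage n (F σ)) ∧
      schur lam = ∑ σ : Equiv.Perm (Fin (rows lam).length),
        ((Equiv.Perm.sign σ : ℤ) : ℂ) • F σ := by
  refine ⟨fun σ => ∏ i, completeSymm (((rows lam).get (σ i) : ℤ) - ((σ i : Fin _) : ℕ) + (i : ℕ)),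
    fun σ => ?_, ?_⟩
  · rcases prod_completeSymm Finset.univ (fun i => ((rows lam).get (σ i) : ℤ) -
      ((σ i : Fin _) : ℕ) + (i : ℕ)) with h | ⟨k, hk, h⟩
    · exact Or.inl h
    · right
      have h1 : ∑ i, (((rows lam).get (σ i) : ℤ) - ((σ i : Fin _) : ℕ) + (i : ℕ)) = n := by
        rw [Finset.sum_add_distrib, Finset.sum_sub_distrib,
          Equiv.sum_comp σ (fun i => ((rows lam).get i : ℤ)),
          Equiv.sum_comp σ (fun i => ((i : ℕ) : ℤ)), sub_add_cancel, ← Nat.cast_sum]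
        congr 1
        rw [← List.sum_ofFn, List.ofFn_get, sum_rows]
      rw [h1] at hk
      have : k = n := by exact_mod_cast hk
      rw [this] at h
      exact h
  · rw [schur, Matrix.det_apply]
    refine Finset.sum_congr rfl fun σ _ => ?_
    rw [Units.smul_def, Int.cast_smul_eq_zsmul]
    rfl

/-! ### Frobenius' formula and character orthogonality. -/

theorem toFinsupp_parts_injective {n : ℕ} :
    Function.Injective fun mu : n.Partition => Multiset.toFinsupp mu.parts := by
  intro mu nu h
  ext1
  exact Multiset.toFinsupp.injective h

theorem coeff_powerSum {n : ℕ} (mu nu : n.Partition) :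
    (powerSum mu).coeff (Multiset.toFinsupp nu.parts) = if mu = nu then 1 else 0 := by
  rw [powerSum_eq_monomial, MvPolynomial.coeff_monomial]
  simp only [toFinsupp_parts_injective.eq_iff]

theorem hall_powerSum {n : ℕ} (mu nu : n.Partition) :
    hall (powerSum mu) (powerSum nu) = if mu = nu then (zFactor mu : ℂ) else 0 := by
  rw [powerSum_eq_monomial mu, hall_monomial, coeff_powerSum, ← zFactor_eq_zMult]
  by_cases h : mu = nu
  · simp [h]
  · simp [h, Ne.symm h]

/-- Rules out monomials other than the `P_μ` with `|μ| = n`. As `chi` only records those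
coefficients, Frobenius' formula depends on this. -/
theorem IsPermAverage.eq_sum_coeff {n : ℕ} {f : MvPolynomial ℕ ℂ} (hf : IsPermAverage n f) :
    f = ∑ mu : n.Partition, f.coeff (Multiset.toFinsupp mu.parts) • powerSum mu := by
  obtain ⟨Y, _, _, ρ, rfl⟩ := hf
  simp only [MvPolynomial.coeff_smul, MvPolynomial.coeff_sum, coeff_powerSum, smul_eq_mul]
  simp only [mul_smul, ← Finset.smul_sum, Finset.sum_smul]
  congr 1
  rw [Finset.sum_comm]
  refine Finset.sum_congr rfl fun y _ => ?_
  simp [ite_smul]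

/-- Frobenius' formula `S_λ = ∑_μ χ_λ(μ) P_μ / Z_μ`. -/
theorem schur_eq_sum_chi {n : ℕ} (lam : n.Partition) :
    schur lam = ∑ mu : n.Partition, (chi lam mu / zFactor mu) • powerSum mu := by
  obtain ⟨F, hF, hS⟩ := schur_eq_sum_isPermAverage lam
  have h1 : ∀ mu : n.Partition, chi lam mu / zFactor mu =
      (schur lam).coeff (Multiset.toFinsupp mu.parts) := by
    intro mu
    rw [chi, mul_div_cancel_left₀ _ (zFactor_ne_zero mu)]
  simp only [h1]
  conv_lhs => rw [hS]
  rw [hS]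
  simp only [MvPolynomial.coeff_sum, MvPolynomial.coeff_smul, Finset.sum_smul, smul_eq_mul,
    mul_smul]
  rw [Finset.sum_comm]
  refine Finset.sum_congr rfl fun σ _ => ?_
  rw [← Finset.smul_sum]
  congr 1
  rcases hF σ with h | h
  · simp [h]
  · exact h.eq_sum_coeff

theorem sum_chi_mul_chi {n : ℕ} (lam nu : n.Partition) :
    ∑ mu : n.Partition, chi lam mu * chi nu mu / zFactor mu = if lam = nu then 1 else 0 := by
  rw [← hall_schur lam nu, schur_eq_sum_chi lam, schur_eq_sum_chi nu, map_sum]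
  simp only [map_sum, map_smul, LinearMap.sum_apply, LinearMap.smul_apply, hall_powerSum,
    smul_eq_mul]
  refine Finset.sum_congr rfl fun mu _ => ?_
  simp only [mul_ite, mul_zero]
  rw [Finset.sum_ite_eq' Finset.univ mu, if_pos (Finset.mem_univ _)]
  have := zFactor_ne_zero mu
  field_simp

/-- The row relations say that a square matrix has a right inverse, which is then also a left
inverse. -/
theorem sum_chi_col {n : ℕ} (mu nu : n.Partition) :
    ∑ lam : n.Partition, chi lam mu * chi lam nu = if mu = nu then (zFactor mu : ℂ) else 0 := by
  classical
  let A : Matrix n.Partition n.Partition ℂ := Matrix.of fun lam mu => chi lam mu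
  let B : Matrix n.Partition n.Partition ℂ := Matrix.of fun mu nu => chi nu mu / zFactor mu
  have h1 : A * B = 1 := by
    ext lam nu
    rw [Matrix.mul_apply, Matrix.one_apply, ← sum_chi_mul_chi]
    exact Finset.sum_congr rfl fun mu _ => (mul_div_assoc _ _ _).symm
  have h2 : B * A = 1 := mul_eq_one_comm.1 h1
  have h3 := congrFun (congrFun h2 mu) nu
  rw [Matrix.mul_apply, Matrix.one_apply] at h3
  simp only [A, B, Matrix.of_apply, div_mul_eq_mul_div, ← Finset.sum_div] at h3
  rw [div_eq_iff (zFactor_ne_zero mu)] at h3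
  rw [h3, ite_mul, one_mul, zero_mul]

/-- Fourier expansion of a function of the cycle type. -/
theorem sum_pairing_mul_chi {n : ℕ} (x : n.Partition → ℂ) (mu : n.Partition) :
    ∑ lam : n.Partition, (∑ nu, x nu * chi lam nu / zFactor nu) * chi lam mu = x mu := by
  simp only [Finset.sum_mul]
  rw [Finset.sum_comm]
  have : ∀ nu, ∑ lam : n.Partition, x nu * chi lam nu / zFactor nu * chi lam mu =
      if nu = mu then x nu else 0 := by
    intro nu
    have h := sum_chi_col nu mu
    have hz := zFactor_ne_zero nu
    calc _ = x nu / zFactor nu * ∑ lam : n.Partition, chi lam nu * chi lam mu := by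
          rw [Finset.mul_sum]
          exact Finset.sum_congr rfl fun _ _ => by ring
      _ = _ := by
          rw [h]
          split_ifs
          · field_simp
          · simp
  simp [this]

/-- Parseval's identity for the bilinear pairing, without complex conjugation. -/
theorem sum_pairing_sq {n : ℕ} (x : n.Partition → ℂ) :
    ∑ lam : n.Partition, (∑ nu, x nu * chi lam nu / zFactor nu) ^ 2 =
      ∑ mu, x mu ^ 2 / zFactor mu := by
  have h : ∀ lam : n.Partition, (∑ nu, x nu * chi lam nu / zFactor nu) ^ 2 =
      ∑ mu, x mu / zFactor mu * ((∑ nu, x nu * chi lam nu / zFactor nu) * chi lam mu) := by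
    intro lam
    rw [sq]
    nth_rewrite 2 [Finset.sum_congr rfl fun nu _ => mul_div_right_comm (x nu) (chi lam nu) _]
    rw [Finset.mul_sum]
    exact Finset.sum_congr rfl fun _ _ => by ring
  rw [Finset.sum_congr rfl fun lam _ => h lam, Finset.sum_comm]
  refine Finset.sum_congr rfl fun mu _ => ?_
  rw [← Finset.mul_sum, sum_pairing_mul_chi]
  ring

/-! ### Coefficients, traces and the centre of the group algebra. -/

theorem cyc_eq_cyc_one_iff {n : ℕ} (g : Equiv.Perm (Fin n)) : cyc g = cyc 1 ↔ g = 1 := by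
  rw [cyc_eq_iff_isConj, isConj_comm, isConj_one_right]

theorem zFactor_cyc_one (n : ℕ) : zFactor (cyc (1 : Equiv.Perm (Fin n))) = n.factorial := by
  have h := card_cyc_mul_zFactor (cyc (1 : Equiv.Perm (Fin n)))
  simpa [cyc_eq_cyc_one_iff, Finset.filter_eq'] using h

theorem coeff_sum_single {n : ℕ} (f : Equiv.Perm (Fin n) → ℂ) (h : Equiv.Perm (Fin n)) :
    (∑ g, MonoidAlgebra.single g (f g) : GroupAlg n).coeff h = f h := by
  classical
  rw [MonoidAlgebra.coeff_sum, Finsupp.finsetSum_apply]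
  simp [Finsupp.single_apply]

theorem sum_single_coeff {n : ℕ} (a : GroupAlg n) :
    ∑ g, MonoidAlgebra.single g (a.coeff g) = a :=
  MonoidAlgebra.ext (Finsupp.ext fun h => coeff_sum_single _ h)

theorem coeff_idem {n : ℕ} (lam : n.Partition) (g : Equiv.Perm (Fin n)) :
    (idem lam).coeff g = chi lam (cyc 1) / (n.factorial : ℂ) * chi lam (cyc g) :=
  coeff_sum_single _ g

theorem sum_idem (n : ℕ) : ∑ lam : n.Partition, idem lam = 1 := by
  classical
  refine MonoidAlgebra.ext (Finsupp.ext fun g => ?_)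
  have hn : (n.factorial : ℂ) ≠ 0 := Nat.cast_ne_zero.2 (Nat.factorial_pos n).ne'
  have h := sum_chi_col (cyc (1 : Equiv.Perm (Fin n))) (cyc g)
  rw [zFactor_cyc_one] at h
  rw [MonoidAlgebra.coeff_sum, Finsupp.finsetSum_apply, MonoidAlgebra.one_def,
    MonoidAlgebra.coeff_single, Finsupp.single_apply]
  simp only [coeff_idem, div_mul_eq_mul_div, ← Finset.sum_div]
  have h1 : cyc 1 = cyc g ↔ 1 = g := by
    rw [eq_comm, cyc_eq_cyc_one_iff, eq_comm]
  rw [h]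
  simp only [h1]
  split_ifs
  · exact div_self hn
  · exact zero_div _

/-- Left multiplication by `g ≠ 1` moves every basis element, so only the coefficient at `1` reaches
the diagonal. -/
theorem trace_mulLeft_groupAlg {n : ℕ} (a : GroupAlg n) :
    LinearMap.trace ℂ (GroupAlg n) (LinearMap.mulLeft ℂ a) = n.factorial * a.coeff 1 := by
  classical
  let b : Module.Basis (Equiv.Perm (Fin n)) ℂ (GroupAlg n) :=
    ⟨MonoidAlgebra.coeffLinearEquiv ℂ⟩
  rw [LinearMap.trace_eq_matrix_trace ℂ b, Matrix.trace]
  have hb : ∀ g, b g = MonoidAlgebra.single g 1 := fun g => rfl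
  have h : ∀ g, (LinearMap.toMatrix b b (LinearMap.mulLeft ℂ a)).diag g = a.coeff 1 := by
    intro g
    rw [Matrix.diag_apply, LinearMap.toMatrix_apply, LinearMap.mulLeft_apply, hb]
    have h1 : b.repr (a * MonoidAlgebra.single g 1) g =
      (a * MonoidAlgebra.single g 1).coeff g := rfl
    rw [h1, MonoidAlgebra.coeff_mul_single_apply, mul_inv_cancel, mul_one]
  rw [Finset.sum_congr rfl fun g _ => h g]
  simp [Fintype.card_perm]

/-- As a left module, a block of size `d` is `d` copies of its column module. -/
theorem trace_mulLeft_pi_matrix {k : ℕ} {d : Fin k → ℕ}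
    (a : (i : Fin k) → Matrix (Fin (d i)) (Fin (d i)) ℂ) :
    LinearMap.trace ℂ _ (LinearMap.mulLeft ℂ a) = ∑ i, (d i : ℂ) * (a i).trace := by
  classical
  let b := Pi.basis fun i : Fin k => Matrix.stdBasis ℂ (Fin (d i)) (Fin (d i))
  rw [LinearMap.trace_eq_matrix_trace ℂ b, Matrix.trace, Fintype.sum_sigma]
  refine Finset.sum_congr rfl fun i _ => ?_
  have h : ∀ x : Fin (d i) × Fin (d i),
      (LinearMap.toMatrix b b (LinearMap.mulLeft ℂ a)).diag ⟨i, x⟩ = a i x.1 x.1 := by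
    intro x
    rw [Matrix.diag_apply, LinearMap.toMatrix_apply, LinearMap.mulLeft_apply, Pi.basis_repr,
      Pi.mul_apply, Pi.basis_apply, Pi.single_eq_same, Matrix.stdBasis_eq_single]
    have hr : ∀ M : Matrix (Fin (d i)) (Fin (d i)) ℂ,
        (Matrix.stdBasis ℂ (Fin (d i)) (Fin (d i))).repr M x = M x.1 x.2 := fun M => rfl
    rw [hr]
    simp
  rw [Finset.sum_congr rfl fun x _ => h x, Fintype.sum_prod_type]
  simp [Matrix.trace, Finset.mul_sum]

theorem cyc_surjective {n : ℕ} : Function.Surjective (cyc (n := n)) := by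
  intro mu
  have h4 : 0 < (Finset.univ.filter fun g : Equiv.Perm (Fin n) => cyc g = mu).card := by
    have := card_cyc_mul_zFactor mu
    refine Nat.pos_of_ne_zero fun h => ?_
    rw [h, zero_mul] at this
    exact (Nat.factorial_pos n).ne this
  obtain ⟨g, hg⟩ := Finset.card_pos.1 h4
  exact ⟨g, (Finset.mem_filter.1 hg).2⟩

/-- Elements of the group algebra whose coefficients depend only on the cycle type are central. -/
theorem sum_single_cyc_mem_center {n : ℕ} (x : n.Partition → ℂ) :
    (∑ g : Equiv.Perm (Fin n), MonoidAlgebra.single g (x (cyc g)) : GroupAlg n) ∈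
      Subalgebra.center ℂ (GroupAlg n) := by
  rw [Subalgebra.mem_center_iff]
  intro b
  rw [← sum_single_coeff b, Finset.sum_mul, Finset.mul_sum]
  refine Finset.sum_congr rfl fun h _ => ?_
  refine MonoidAlgebra.ext (Finsupp.ext fun k => ?_)
  rw [MonoidAlgebra.coeff_single_mul_apply, MonoidAlgebra.coeff_mul_single_apply, coeff_sum_single,
    coeff_sum_single, cyc_mul_comm, mul_comm]

theorem idem_mem_center {n : ℕ} (lam : n.Partition) :
    idem lam ∈ Subalgebra.center ℂ (GroupAlg n) :=
  sum_single_cyc_mem_center fun mu => chi lam (cyc 1) / (n.factorial : ℂ) * chi lam mu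

/-- The trace of a projection is the dimension of its range. -/
theorem trace_eq_natCast_of_isIdempotentElem {d : ℕ} {p : Matrix (Fin d) (Fin d) ℂ}
    (hp : p * p = p) : ∃ k : ℕ, p.trace = k := by
  have h1 : IsIdempotentElem (Matrix.toLin' p) := by
    rw [IsIdempotentElem, Module.End.mul_eq_comp, ← Matrix.toLin'_mul, hp]
  have h2 := (LinearMap.IsIdempotentElem.isProj_range _ h1).trace
  rw [Matrix.trace_toLin'_eq] at h2
  exact ⟨_, h2⟩

theorem exists_unique_unit_of_sum_sq {ι : Type*} [Fintype ι] {a : ι → ℤ}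
    (ha : ∑ i, a i ^ 2 = 1) : ∃ i, a i ^ 2 = 1 ∧ ∀ j, j ≠ i → a j = 0 := by
  classical
  obtain ⟨i, hi⟩ : ∃ i, a i ≠ 0 := by
    by_contra! h
    simp [h] at ha
  have h1 : 1 ≤ a i ^ 2 := by
    have := pow_pos (abs_pos.2 hi) 2
    rw [sq_abs] at this
    omega
  rw [← Finset.add_sum_erase _ _ (Finset.mem_univ i)] at ha
  have h2 : 0 ≤ ∑ j ∈ Finset.univ.erase i, a j ^ 2 := Finset.sum_nonneg fun j _ => sq_nonneg _
  have h3 : ∑ j ∈ Finset.univ.erase i, a j ^ 2 = 0 := by omega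
  refine ⟨i, by omega, fun j hj => ?_⟩
  have := (Finset.sum_eq_zero_iff_of_nonneg fun j _ => sq_nonneg (a j)).1 h3 j
    (Finset.mem_erase.2 ⟨hj, Finset.mem_univ j⟩)
  exact pow_eq_zero_iff two_ne_zero |>.1 this

/-! ### Wedderburn blocks and Frobenius characters. -/

section Wedderburn

variable {n k : ℕ} {d : Fin k → ℕ}
  (Φ : GroupAlg n ≃ₐ[ℂ] ((i : Fin k) → Matrix (Fin (d i)) (Fin (d i)) ℂ))

/-- The character of a block of the group algebra. -/
def blockChar (i : Fin k) (g : Equiv.Perm (Fin n)) : ℂ := (Φ (MonoidAlgebra.single g 1) i).trace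

/-- The central idempotent of a block of the group algebra. -/
def blockIdem (i : Fin k) : GroupAlg n := Φ.symm (Pi.single i 1)

theorem blockChar_mul_comm (i : Fin k) (g h : Equiv.Perm (Fin n)) :
    blockChar Φ i (g * h) = blockChar Φ i (h * g) := by
  have h1 : ∀ g h : Equiv.Perm (Fin n), (MonoidAlgebra.single (g * h) 1 : GroupAlg n) =
      MonoidAlgebra.single g 1 * MonoidAlgebra.single h 1 := by
    intro g h
    rw [MonoidAlgebra.single_mul_single, mul_one]
  rw [blockChar, blockChar, h1, h1, map_mul, map_mul, Pi.mul_apply, Pi.mul_apply,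
    Matrix.trace_mul_comm]

theorem blockChar_eq_of_cyc_eq (i : Fin k) {g h : Equiv.Perm (Fin n)} (hgh : cyc g = cyc h) :
    blockChar Φ i g = blockChar Φ i h := by
  rw [cyc_eq_iff_isConj, isConj_iff] at hgh
  obtain ⟨c, rfl⟩ := hgh
  rw [blockChar_mul_comm]
  congr 1
  group

theorem exists_blockChar_eq (i : Fin k) :
    ∃ x : n.Partition → ℂ, ∀ g, blockChar Φ i g = x (cyc g) := by
  classical
  refine ⟨fun mu => if h : ∃ g, cyc g = mu then blockChar Φ i h.choose else 0, fun g => ?_⟩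
  have h : ∃ g', cyc g' = cyc g := ⟨g, rfl⟩
  simp only [dif_pos h]
  exact blockChar_eq_of_cyc_eq Φ i h.choose_spec.symm

theorem trace_block (i : Fin k) (a : GroupAlg n) :
    (Φ a i).trace = ∑ g, a.coeff g * blockChar Φ i g := by
  have h : Φ a = ∑ g, a.coeff g • Φ (MonoidAlgebra.single g 1) := by
    conv_lhs => rw [← sum_single_coeff a]
    rw [map_sum]
    refine Finset.sum_congr rfl fun g _ => ?_
    rw [← map_smul, MonoidAlgebra.smul_single, smul_eq_mul, mul_one]
  rw [h, Finset.sum_apply, Matrix.trace_sum]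
  exact Finset.sum_congr rfl fun g _ => by rw [Pi.smul_apply, Matrix.trace_smul]; rfl

/-- Fourier inversion at the identity: one trace, of left multiplication by `a`, computed in the
basis of permutations and in the blocks. -/
theorem factorial_mul_coeff_one (a : GroupAlg n) :
    (n.factorial : ℂ) * a.coeff 1 = ∑ i, (d i : ℂ) * (Φ a i).trace := by
  rw [← trace_mulLeft_groupAlg, ← trace_mulLeft_pi_matrix,
    ← LinearMap.trace_conj' (LinearMap.mulLeft ℂ a) Φ.toLinearEquiv]
  congr 1
  refine LinearMap.ext fun x => ?_
  simp [LinearEquiv.conj_apply]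

/-- Inversion is applied to the block idempotent times `g⁻¹`, which lives in block `i` alone. In
`S_n` the elements `g` and `g⁻¹` are conjugate, so no inverse survives in the formula. -/
theorem coeff_blockIdem (i : Fin k) (g : Equiv.Perm (Fin n)) :
    (blockIdem Φ i).coeff g = d i / (n.factorial : ℂ) * blockChar Φ i g := by
  classical
  have hn : (n.factorial : ℂ) ≠ 0 := Nat.cast_ne_zero.2 (Nat.factorial_pos n).ne'
  have h1 := factorial_mul_coeff_one Φ (blockIdem Φ i * MonoidAlgebra.single g⁻¹ 1)
  rw [MonoidAlgebra.coeff_mul_single_apply, inv_inv, one_mul, mul_one] at h1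
  have h2 : ∀ j, (d j : ℂ) * (Φ (blockIdem Φ i * MonoidAlgebra.single g⁻¹ 1) j).trace =
      if j = i then (d i : ℂ) * blockChar Φ i g else 0 := by
    intro j
    rw [map_mul, blockIdem, AlgEquiv.apply_symm_apply, Pi.mul_apply]
    split_ifs with h
    · subst h
      rw [Pi.single_eq_same, one_mul]
      congr 1
      exact blockChar_eq_of_cyc_eq Φ j (cyc_inv g)
    · rw [Pi.single_eq_of_ne h, zero_mul, Matrix.trace_zero, mul_zero]
  rw [Finset.sum_congr rfl fun j _ => h2 j, Finset.sum_ite_eq', if_pos (Finset.mem_univ i)] at h1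
  field_simp
  linear_combination h1

theorem blockChar_one (i : Fin k) : blockChar Φ i 1 = d i := by
  rw [blockChar, ← MonoidAlgebra.one_def, map_one, Pi.one_apply, Matrix.trace_one, Fintype.card_fin]

/-- The trace of the block idempotent in its own block is `d i`; inserting its coefficients gives
the norm of the character. -/
theorem sum_blockChar_sq [∀ i, NeZero (d i)] (i : Fin k) :
    ∑ g, blockChar Φ i g ^ 2 = n.factorial := by
  have hn : (n.factorial : ℂ) ≠ 0 := Nat.cast_ne_zero.2 (Nat.factorial_pos n).ne'
  have hd : (d i : ℂ) ≠ 0 := Nat.cast_ne_zero.2 (NeZero.ne (d i))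
  have h1 := trace_block Φ i (blockIdem Φ i)
  rw [blockIdem, AlgEquiv.apply_symm_apply, Pi.single_eq_same, Matrix.trace_one, Fintype.card_fin,
    ← blockIdem] at h1
  simp only [coeff_blockIdem, mul_assoc, ← Finset.mul_sum, ← sq] at h1
  field_simp at h1
  exact h1.symm

/-- The pairing is the trace of the averaging operator of `Y` in the block representation pulled
back along `ρ`. That operator is a projection, onto the `Y`-invariants, so its trace is a natural
number. -/
theorem IsPermAverage.pairing_blockChar (i : Fin k) {x : n.Partition → ℂ}
    (hx : ∀ g, blockChar Φ i g = x (cyc g)) {f : MvPolynomial ℕ ℂ} (hf : IsPermAverage n f) :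
    ∃ r : ℕ, ∑ mu, x mu * f.coeff (Multiset.toFinsupp mu.parts) = r := by
  classical
  obtain ⟨Y, _, _, ρ, rfl⟩ := hf
  let c : ℂ := 1 / (Fintype.card Y : ℂ)
  have hY : (Fintype.card Y : ℂ) ≠ 0 := Nat.cast_ne_zero.2 Fintype.card_ne_zero
  let ψ : Y →* Matrix (Fin (d i)) (Fin (d i)) ℂ :=
    ((Pi.evalMonoidHom (fun i => Matrix (Fin (d i)) (Fin (d i)) ℂ) i).comp (Φ : GroupAlg n →* _)).comp
      ((MonoidAlgebra.of ℂ (Equiv.Perm (Fin n))).comp ρ)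
  have hψ : ∀ y, (ψ y).trace = x (cyc (ρ y)) := fun y => hx (ρ y)
  have hp : (c • ∑ y, ψ y) * (c • ∑ y, ψ y) = c • ∑ y, ψ y := by
    have h1 : ∀ y, ψ y * ∑ z, ψ z = ∑ z, ψ z := by
      intro y
      rw [Finset.mul_sum]
      simp only [← map_mul]
      exact Fintype.sum_equiv (Equiv.mulLeft y) _ _ fun _ => rfl
    rw [smul_mul_smul_comm, Finset.sum_mul, Finset.sum_congr rfl fun y _ => h1 y,
      Finset.sum_const, ← Nat.cast_smul_eq_nsmul ℂ, smul_smul, Finset.card_univ]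
    congr 1
    simp only [c]
    field_simp
  obtain ⟨r, hr⟩ := trace_eq_natCast_of_isIdempotentElem hp
  refine ⟨r, ?_⟩
  rw [← hr, Matrix.trace_smul, Matrix.trace_sum, Finset.sum_congr rfl fun y _ => hψ y]
  simp only [MvPolynomial.coeff_smul, MvPolynomial.coeff_sum, coeff_powerSum, smul_eq_mul]
  simp only [mul_left_comm _ (1 / (Fintype.card Y : ℂ)), ← Finset.mul_sum]
  congr 1
  simp only [Finset.mul_sum]
  rw [Finset.sum_comm]
  exact Finset.sum_congr rfl fun y _ => by simp

theorem pairing_blockChar_chi (i : Fin k) {x : n.Partition → ℂ}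
    (hx : ∀ g, blockChar Φ i g = x (cyc g)) (lam : n.Partition) :
    ∃ r : ℤ, ∑ mu, x mu * chi lam mu / zFactor mu = r := by
  obtain ⟨F, hF, hS⟩ := schur_eq_sum_isPermAverage lam
  have h1 : ∀ σ, ∃ r : ℕ, ∑ mu, x mu * (F σ).coeff (Multiset.toFinsupp mu.parts) = r := by
    intro σ
    rcases hF σ with h | h
    · exact ⟨0, by simp [h]⟩
    · exact h.pairing_blockChar Φ i hx
  choose r hr using h1
  refine ⟨∑ σ, (Equiv.Perm.sign σ : ℤ) * r σ, ?_⟩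
  have h2 : ∀ mu : n.Partition, x mu * chi lam mu / zFactor mu =
      ∑ σ, ((Equiv.Perm.sign σ : ℤ) : ℂ) *
        (x mu * (F σ).coeff (Multiset.toFinsupp mu.parts)) := by
    intro mu
    rw [chi, hS, mul_left_comm, mul_div_cancel_left₀ _ (zFactor_ne_zero mu)]
    simp only [MvPolynomial.coeff_sum, MvPolynomial.coeff_smul, smul_eq_mul, Finset.mul_sum]
    exact Finset.sum_congr rfl fun σ _ => by ring
  rw [Finset.sum_congr rfl fun mu _ => h2 mu, Finset.sum_comm]
  push_cast
  refine Finset.sum_congr rfl fun σ _ => ?_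
  rw [← Finset.mul_sum, hr]

/-- The character of a block is a Frobenius character up to sign. -/
theorem exists_blockChar_eq_chi [∀ i, NeZero (d i)] (i : Fin k) :
    ∃ (lam : n.Partition) (ε : ℂ), ε ^ 2 = 1 ∧ ∀ g, blockChar Φ i g = ε * chi lam (cyc g) := by
  obtain ⟨x, hx⟩ := exists_blockChar_eq Φ i
  have hn : (n.factorial : ℂ) ≠ 0 := Nat.cast_ne_zero.2 (Nat.factorial_pos n).ne'
  choose a ha using pairing_blockChar_chi Φ i hx
  have h1 : ∑ mu, x mu ^ 2 / zFactor mu = 1 := by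
    have h2 := sum_blockChar_sq Φ i
    simp only [hx] at h2
    rw [sum_cyc fun mu => x mu ^ 2] at h2
    refine mul_left_cancel₀ hn ?_
    rw [mul_one]
    refine Eq.trans ?_ h2
    rw [Finset.mul_sum]
    exact Finset.sum_congr rfl fun mu _ => by rw [smul_eq_mul]; ring
  -- Parseval carries the norm one over to the integer coordinates `a lam`, so exactly one of them
  -- is `± 1` and the rest vanish.
  have h3 : ∑ lam, a lam ^ 2 = 1 := by
    have h4 := sum_pairing_sq x
    simp only [ha] at h4
    rw [h1] at h4
    exact_mod_cast h4
  obtain ⟨lam, h5, h6⟩ := exists_unique_unit_of_sum_sq h3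
  refine ⟨lam, a lam, by exact_mod_cast h5, fun g => ?_⟩
  rw [hx, ← sum_pairing_mul_chi x (cyc g), Finset.sum_eq_single lam]
  · rw [ha]
  · intro nu _ hnu
    rw [ha, h6 nu hnu]
    simp
  · simp

/-- Commuting with the matrix units placed in block `i` already forces a scalar matrix there. -/
theorem exists_scalar_of_mem_center (i : Fin k) {z : GroupAlg n}
    (hz : z ∈ Subalgebra.center ℂ (GroupAlg n)) :
    ∃ s : ℂ, Φ z i = s • (1 : Matrix (Fin (d i)) (Fin (d i)) ℂ) := by
  classical
  have h : Φ z i ∈ Set.range (Matrix.scalar (Fin (d i))) := by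
    refine Matrix.mem_range_scalar_of_commute_single fun p q _ => ?_
    have h1 := (Subalgebra.mem_center_iff.1 hz)
      (Φ.symm (Pi.single i (Matrix.single p q 1)))
    have h2 := congrFun (congrArg Φ h1) i
    have h3 : Matrix.single p q 1 * Φ z i = Φ z i * Matrix.single p q 1 := by
      simpa using h2
    exact h3
  obtain ⟨s, hs⟩ := h
  refine ⟨s, ?_⟩
  rw [← hs, Matrix.scalar_apply, Matrix.smul_one_eq_diagonal]

/-- Every Frobenius character is the character of a block, up to sign. -/
theorem exists_block_of_chi [∀ i, NeZero (d i)] (lam : n.Partition) :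
    ∃ (i : Fin k) (ε : ℂ), ε ^ 2 = 1 ∧ ∀ g, blockChar Φ i g = ε * chi lam (cyc g) := by
  -- Otherwise the central element `∑ χ_λ(g) g` pairs to zero with every block character, so its
  -- scalar in each block is `0` and it vanishes. This contradicts the norm one of `χ_λ`.
  by_contra! hcon
  have hz := sum_single_cyc_mem_center (chi lam)
  set z : GroupAlg n := ∑ g : Equiv.Perm (Fin n), MonoidAlgebra.single g (chi lam (cyc g)) with hzdef
  have h1 : Φ z = 0 := by
    ext1 i
    obtain ⟨nu, ε, hε, hnu⟩ := exists_blockChar_eq_chi Φ i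
    obtain ⟨s, hs⟩ := exists_scalar_of_mem_center Φ i hz
    have hne : lam ≠ nu := by
      rintro rfl
      obtain ⟨g, hg⟩ := hcon i ε hε
      exact hg (hnu g)
    have h2 := trace_block Φ i z
    have h3 : ∑ g, z.coeff g * blockChar Φ i g = 0 := by
      have h4 : ∀ g, z.coeff g * blockChar Φ i g = ε * (chi lam (cyc g) * chi nu (cyc g)) := by
        intro g
        rw [hzdef, coeff_sum_single, hnu]
        ring
      have h5 := sum_chi_mul_chi lam nu
      rw [if_neg hne] at h5
      rw [Finset.sum_congr rfl fun g _ => h4 g, ← Finset.mul_sum,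
        sum_cyc fun mu => chi lam mu * chi nu mu]
      have h6 : ∑ mu, ((n.factorial : ℂ) / zFactor mu) • (chi lam mu * chi nu mu) =
          n.factorial * ∑ mu, chi lam mu * chi nu mu / zFactor mu := by
        rw [Finset.mul_sum]
        exact Finset.sum_congr rfl fun mu _ => by rw [smul_eq_mul]; ring
      rw [h6, h5, mul_zero, mul_zero]
    rw [h3, hs, Matrix.trace_smul, Matrix.trace_one, Fintype.card_fin, smul_eq_mul] at h2
    have hd : (d i : ℂ) ≠ 0 := Nat.cast_ne_zero.2 (NeZero.ne (d i))
    rw [hs, (mul_eq_zero.1 h2).resolve_right hd, zero_smul, Pi.zero_apply]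
  have h2 : z = 0 := by simpa using h1
  have h3 : ∀ mu : n.Partition, chi lam mu = 0 := by
    intro mu
    obtain ⟨g, rfl⟩ := cyc_surjective mu
    rw [← coeff_sum_single (fun g => chi lam (cyc g)) g, ← hzdef, h2]
    rfl
  have h4 := sum_chi_mul_chi lam lam
  simp [h3] at h4

/-- The sign enters twice, through the dimension `d i = ε χ_λ(1)` and through the character, and
cancels. -/
theorem blockIdem_eq_idem {i : Fin k} {lam : n.Partition} {ε : ℂ} (hε : ε ^ 2 = 1)
    (h : ∀ g, blockChar Φ i g = ε * chi lam (cyc g)) : blockIdem Φ i = idem lam := by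
  refine MonoidAlgebra.ext (Finsupp.ext fun g => ?_)
  rw [coeff_blockIdem, coeff_idem, ← blockChar_one Φ i, h, h]
  linear_combination (chi lam (cyc 1) / n.factorial * chi lam (cyc g)) * hε

end Wedderburn

/-! ### The idempotents `F_λ`. -/

theorem exists_wedderburn (n : ℕ) : ∃ (k : ℕ) (d : Fin k → ℕ), (∀ i, NeZero (d i)) ∧
    Nonempty (GroupAlg n ≃ₐ[ℂ] ((i : Fin k) → Matrix (Fin (d i)) (Fin (d i)) ℂ)) :=
  IsSemisimpleRing.exists_algEquiv_pi_matrix_of_isAlgClosed ℂ (GroupAlg n)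

theorem chi_one_ne_zero {n : ℕ} (lam : n.Partition) : chi lam (cyc 1) ≠ 0 := by
  obtain ⟨k, d, _, ⟨Φ⟩⟩ := exists_wedderburn n
  obtain ⟨i, ε, hε, h⟩ := exists_block_of_chi Φ lam
  have h1 := h 1
  rw [blockChar_one] at h1
  have hd : (d i : ℂ) ≠ 0 := Nat.cast_ne_zero.2 (NeZero.ne (d i))
  rw [h1] at hd
  exact right_ne_zero_of_mul hd

theorem idem_ne_zero {n : ℕ} (lam : n.Partition) : idem lam ≠ 0 := by
  intro h
  have h1 := coeff_idem lam 1
  have hn : (n.factorial : ℂ) ≠ 0 := Nat.cast_ne_zero.2 (Nat.factorial_pos n).ne'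
  rw [h] at h1
  exact mul_ne_zero (div_ne_zero (chi_one_ne_zero lam) hn) (chi_one_ne_zero lam) h1.symm

theorem idem_mul_idem {n : ℕ} (lam nu : n.Partition) :
    idem lam * idem nu = if lam = nu then idem lam else 0 := by
  classical
  obtain ⟨k, d, _, ⟨Φ⟩⟩ := exists_wedderburn n
  obtain ⟨i, ε, hε, hi⟩ := exists_block_of_chi Φ lam
  obtain ⟨j, δ, hδ, hj⟩ := exists_block_of_chi Φ nu
  by_cases hln : lam = nu
  · subst hln
    rw [if_pos rfl, ← blockIdem_eq_idem Φ hε hi, blockIdem, ← map_mul, ← Pi.single_mul, one_mul]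
  · have hij : i ≠ j := by
      rintro rfl
      have h1 : ∀ mu : n.Partition, ε * chi lam mu = δ * chi nu mu := by
        intro mu
        obtain ⟨g, rfl⟩ := cyc_surjective mu
        rw [← hi, ← hj]
      have h2 := sum_chi_mul_chi lam lam
      have h3 := sum_chi_mul_chi lam nu
      rw [if_pos rfl] at h2
      rw [if_neg hln] at h3
      have h4 : ε * ∑ mu : n.Partition, chi lam mu * chi lam mu / zFactor mu =
          δ * ∑ mu : n.Partition, chi lam mu * chi nu mu / zFactor mu := by
        rw [Finset.mul_sum, Finset.mul_sum]
        refine Finset.sum_congr rfl fun mu _ => ?_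
        linear_combination (chi lam mu / zFactor mu) * h1 mu
      rw [h2, h3, mul_one, mul_zero] at h4
      simp [h4] at hε
    rw [if_neg hln, ← blockIdem_eq_idem Φ hε hi, ← blockIdem_eq_idem Φ hδ hj, blockIdem, blockIdem,
      ← map_mul]
    have h5 : (Pi.single i 1 * Pi.single j 1 :
        (i : Fin k) → Matrix (Fin (d i)) (Fin (d i)) ℂ) = 0 := by
      ext1 l
      rw [Pi.mul_apply, Pi.zero_apply]
      by_cases hl : l = i
      · subst hl
        rw [Pi.single_eq_of_ne hij, mul_zero]
      · rw [Pi.single_eq_of_ne hl, zero_mul]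
    rw [h5, map_zero]

/-- A central element acts on `F_λ` by its normalized character value. -/
theorem center_mul_idem {n : ℕ} (lam : n.Partition) {z : GroupAlg n}
    (hz : z ∈ Subalgebra.center ℂ (GroupAlg n)) :
    z * idem lam = ((∑ g, z.coeff g * chi lam (cyc g)) / chi lam (cyc 1)) • idem lam := by
  classical
  obtain ⟨k, d, _, ⟨Φ⟩⟩ := exists_wedderburn n
  obtain ⟨i, ε, hε, hi⟩ := exists_block_of_chi Φ lam
  obtain ⟨s, hs⟩ := exists_scalar_of_mem_center Φ i hz
  have h1 := trace_block Φ i z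
  rw [hs, Matrix.trace_smul, Matrix.trace_one, Fintype.card_fin, smul_eq_mul, ← blockChar_one Φ i,
    hi 1] at h1
  have h2 : ∑ g, z.coeff g * blockChar Φ i g = ε * ∑ g, z.coeff g * chi lam (cyc g) := by
    rw [Finset.mul_sum]
    exact Finset.sum_congr rfl fun g _ => by rw [hi]; ring
  have hε0 : ε ≠ 0 := by
    rintro rfl
    simp at hε
  -- The trace of a scalar on the block is `s` times the dimension; the sign `ε` occurs on both
  -- sides.
  have h3 : s = (∑ g, z.coeff g * chi lam (cyc g)) / chi lam (cyc 1) := by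
    rw [eq_div_iff (chi_one_ne_zero lam)]
    refine mul_left_cancel₀ hε0 ?_
    rw [← h2, ← h1]
    ring
  rw [← h3, ← blockIdem_eq_idem Φ hε hi]
  apply Φ.injective
  rw [map_mul, map_smul, blockIdem, AlgEquiv.apply_symm_apply]
  ext1 j
  rw [Pi.mul_apply, Pi.smul_apply]
  by_cases hj : j = i
  · subst hj
    rw [hs, Pi.single_eq_same, mul_one]
  · rw [Pi.single_eq_of_ne hj, mul_zero, smul_zero]

/-! ### Transposition length and Jucys' formula. -/

/-- The length `∑ᵢ (μᵢ - 1)` of the elements of the class `μ` with respect to transpositions. -/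
def classLength {n : ℕ} (mu : n.Partition) : ℕ := (mu.parts.map fun i => i - 1).sum

theorem classLength_cyc {n : ℕ} (g : Equiv.Perm (Fin n)) :
    classLength (cyc g) = (g.cycleType.map fun i => i - 1).sum := by
  rw [classLength, cyc_parts, Multiset.map_add, Multiset.sum_add, Multiset.map_replicate,
    Multiset.sum_replicate]
  simp

theorem classLength_cyc_eq_zero_iff {n : ℕ} (g : Equiv.Perm (Fin n)) :
    classLength (cyc g) = 0 ↔ g = 1 := by
  rw [classLength_cyc, Multiset.sum_eq_zero_iff, ← Equiv.Perm.cycleType_eq_zero]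
  constructor
  · intro h
    rw [Multiset.eq_zero_iff_forall_notMem]
    intro a ha
    have h1 := h _ (Multiset.mem_map_of_mem _ ha)
    have h2 := Equiv.Perm.two_le_of_mem_cycleType ha
    omega
  · intro h
    simp [h]

theorem cycleType_formPerm_of_nodup {α : Type*} [Fintype α] [DecidableEq α] {l : List α}
    (hl : l.Nodup) (h2 : 2 ≤ l.length) : l.formPerm.cycleType = {l.length} := by
  rw [(List.isCycle_formPerm hl h2).cycleType, List.support_formPerm_of_nodup l hl,
    List.toFinset_card_of_nodup hl]
  rintro x rfl
  simp at h2

/-- The product inserts the fixed point `k` into the cycle through `x`, or creates a 2-cycle if `x`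
is fixed as well. The other cycles are untouched. -/
theorem length_swap_mul {α : Type*} [Fintype α] [DecidableEq α] {g : Equiv.Perm α} {k x : α}
    (hk : g k = k) (hx : x ≠ k) :
    ((Equiv.swap k x * g).cycleType.map fun i => i - 1).sum =
      (g.cycleType.map fun i => i - 1).sum + 1 := by
  by_cases hgx : g x = x
  · have hd : Equiv.Perm.Disjoint (Equiv.swap k x) g := by
      intro y
      by_cases h1 : y = k
      · exact Or.inr (h1 ▸ hk)
      by_cases h2 : y = x
      · exact Or.inr (h2 ▸ hgx)
      · exact Or.inl (Equiv.swap_apply_of_ne_of_ne h1 h2)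
    have hs : (Equiv.swap k x).cycleType = {2} :=
      Equiv.Perm.isSwap_iff_cycleType.1 ⟨k, x, hx.symm, rfl⟩
    rw [hd.cycleType_mul, hs]
    simp [add_comm]
  · have hxs : x ∈ g.support := Equiv.Perm.mem_support.2 hgx
    set l := g.toList x with hl
    set c := g.cycleOf x with hc
    have hlc : l.formPerm = c := Equiv.Perm.formPerm_toList g x
    have hlen : 2 ≤ l.length := Equiv.Perm.two_le_length_toList_iff_mem_support.2 hxs
    have hnd : l.Nodup := Equiv.Perm.nodup_toList g x
    obtain ⟨y, t, hyt⟩ : ∃ y t, l = y :: t := by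
      rcases hl' : l with _ | ⟨y, t⟩
      · rw [hl'] at hlen
        simp at hlen
      · exact ⟨y, t, rfl⟩
    have hyx : y = x := by
      have h := Equiv.Perm.toList_getElem_zero g x hxs
      have h' : l[0]'(by omega) = x := h
      simpa [hyt] using h'
    subst hyx
    have hkl : k ∉ l := by
      intro h
      rw [hl, Equiv.Perm.mem_toList_iff] at h
      exact (Equiv.Perm.mem_support.1 ((Equiv.Perm.SameCycle.mem_support_iff h.1).1 h.2)) hk
    have hck : c k = k := by
      rw [← hlc]
      exact List.formPerm_apply_of_notMem hkl
    have hcmem : c ∈ g.cycleFactorsFinset := Equiv.Perm.cycleOf_mem_cycleFactorsFinset_iff.2 hxs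
    set r := g * c⁻¹ with hr
    have hd : Equiv.Perm.Disjoint r c :=
      Equiv.Perm.disjoint_mul_inv_of_mem_cycleFactorsFinset hcmem
    have hg : g = r * c := by rw [hr, inv_mul_cancel_right]
    have hrk : r k = k := by
      have : c⁻¹ k = k := by
        rw [Equiv.Perm.inv_eq_iff_eq, hck]
      rw [hr, Equiv.Perm.mul_apply, this, hk]
    have hnd' : (k :: l).Nodup := List.nodup_cons.2 ⟨hkl, hnd⟩
    -- With the cycle written as a list that starts at the swapped point, the transposition prepends
    -- `k` to the list.
    have hkx : Equiv.swap k y * c = (k :: l).formPerm := by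
      rw [← hlc, hyt, List.formPerm_cons_cons]
    have hh : Equiv.swap k y * g = r * (k :: l).formPerm := by
      rw [← hkx, hg, hd.commute.eq, ← mul_assoc]
      have hd2 : Equiv.Perm.Disjoint (Equiv.swap k y * c) r := by
        intro z
        by_cases hz : z ∈ k :: l
        · right
          rcases List.mem_cons.1 hz with rfl | hz
          · exact hrk
          · rcases hd z with h | h
            · exact h
            · exfalso
              rw [← hlc] at h
              exact List.formPerm_apply_mem_ne_self_iff l hnd z hz |>.2 hlen h
        · left
          rw [hkx]
          exact List.formPerm_apply_of_notMem hz
      exact hd2.commute.eq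
    have hd2 : Equiv.Perm.Disjoint r (k :: l).formPerm := by
      intro z
      by_cases hz : z ∈ k :: l
      · left
        rcases List.mem_cons.1 hz with rfl | hz
        · exact hrk
        · rcases hd z with h | h
          · exact h
          · exfalso
            rw [← hlc] at h
            exact List.formPerm_apply_mem_ne_self_iff l hnd z hz |>.2 hlen h
      · right
        exact List.formPerm_apply_of_notMem hz
    rw [hh, hd2.cycleType_mul, hg, hd.cycleType_mul, ← hlc,
      cycleType_formPerm_of_nodup hnd hlen,
      cycleType_formPerm_of_nodup hnd' (by rw [List.length_cons]; omega)]
    simp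
    omega

theorem classLength_mul_swap {n : ℕ} {g : Equiv.Perm (Fin n)} {a k : Fin n} (hk : g k = k)
    (ha : a ≠ k) : classLength (cyc (g * Equiv.swap a k)) = classLength (cyc g) + 1 := by
  have h : g * Equiv.swap a k = Equiv.swap k (g a) * g := by
    rw [Equiv.swap_comm a k, Equiv.mul_swap_eq_swap_mul, hk]
  rw [h, classLength_cyc, classLength_cyc]
  refine length_swap_mul hk fun hc => ha ?_
  rw [← hk] at hc
  exact g.injective hc

/-- Jucys' formula. -/
theorem elemJM_eq_sum (n : ℕ) (w : ℂ) : elemJM n w =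
    ∑ g : Equiv.Perm (Fin n), MonoidAlgebra.single g (w ^ classLength (cyc g)) := by
  classical
  -- A copy of `S_t`, the permutations that move only positions below `t`.
  let S : ℕ → Finset (Equiv.Perm (Fin n)) := fun t =>
    Finset.univ.filter fun g => ∀ b : Fin n, t ≤ (b : ℕ) → g b = b
  have key : ∀ t ≤ n, ((List.ofFn fun b : Fin n => 1 + w • jucysMurphy b).take t).prod =
      ∑ g ∈ S t, (MonoidAlgebra.single g (w ^ classLength (cyc g)) : GroupAlg n) := by
    intro t ht
    induction t with
    | zero =>
      have : S 0 = {1} := by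
        ext g
        simp [S, Equiv.ext_iff]
      rw [this, Finset.sum_singleton, (classLength_cyc_eq_zero_iff 1).2 rfl]
      simp [MonoidAlgebra.one_def]
    | succ t ih =>
      have htn : t < n := ht
      let k : Fin n := ⟨t, htn⟩
      rw [List.prod_take_succ _ _ (by simpa using htn), ih (by omega), List.getElem_ofFn]
      -- Coset decomposition: each `h` in `S (t + 1)` is uniquely `g (a k)` with `g ∈ S t` and `a =
      -- h⁻¹ k ≤ k`. The choice `a = k` is the summand `1` of `1 + w 𝒥_k`; each `a < k` raises the
      -- length by one.
      have h1 : ∑ p ∈ S t ×ˢ Finset.univ.filter (fun a : Fin n => a ≤ k),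
          (MonoidAlgebra.single (p.1 * Equiv.swap p.2 k)
            (w ^ classLength (cyc (p.1 * Equiv.swap p.2 k))) : GroupAlg n) =
          ∑ g ∈ S (t + 1), MonoidAlgebra.single g (w ^ classLength (cyc g)) := by
        refine Finset.sum_nbij' (fun p => p.1 * Equiv.swap p.2 k)
          (fun h => (h * Equiv.swap (h⁻¹ k) k, h⁻¹ k)) ?_ ?_ ?_ ?_ ?_
        · rintro ⟨g, a⟩ hp
          simp only [Finset.mem_product, Finset.mem_filter, Finset.mem_univ, true_and, S] at hp ⊢
          intro b hb
          have hbk : b ≠ k := by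
            rintro rfl
            simp [k] at hb
          have hba : b ≠ a := by
            rintro rfl
            have : (b : ℕ) ≤ t := hp.2
            omega
          rw [Equiv.Perm.mul_apply, Equiv.swap_apply_of_ne_of_ne hba hbk]
          exact hp.1 b (by omega)
        · intro h hh
          simp only [Finset.mem_product, Finset.mem_filter, Finset.mem_univ, true_and, S] at hh ⊢
          have hle : h⁻¹ k ≤ k := by
            by_contra hcon
            have h2 : t + 1 ≤ ((h⁻¹ k : Fin n) : ℕ) := by
              have : k < h⁻¹ k := not_le.1 hcon
              exact this
            have h3 := hh _ h2
            rw [Equiv.Perm.inv_def, Equiv.apply_symm_apply] at h3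
            exact hcon h3.ge
          refine ⟨fun b hb => ?_, hle⟩
          rw [Equiv.Perm.mul_apply]
          rcases eq_or_ne b k with rfl | hbk
          · rw [Equiv.swap_apply_right, Equiv.Perm.inv_def, Equiv.apply_symm_apply]
          · have hkb : t + 1 ≤ (b : ℕ) := by
              have : (b : ℕ) ≠ t := fun h => hbk (Fin.ext h)
              omega
            have hba : b ≠ h⁻¹ k := by
              rintro rfl
              have : ((h⁻¹ k : Fin n) : ℕ) ≤ t := hle
              omega
            rw [Equiv.swap_apply_of_ne_of_ne hba hbk]
            exact hh b hkb
        · rintro ⟨g, a⟩ hp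
          simp only [Finset.mem_product, Finset.mem_filter, Finset.mem_univ, true_and, S] at hp
          have h2 : (g * Equiv.swap a k)⁻¹ k = a := by
            rw [Equiv.Perm.inv_eq_iff_eq, Equiv.Perm.mul_apply, Equiv.swap_apply_left]
            exact (hp.1 k le_rfl).symm
          simp only [h2, Prod.mk.injEq, and_true]
          rw [mul_assoc, Equiv.swap_mul_self, mul_one]
        · intro h _
          simp only
          rw [mul_assoc, Equiv.swap_mul_self, mul_one]
        · intro p _
          rfl
      have h2 : Finset.univ.filter (fun a : Fin n => a ≤ k) =
          insert k (Finset.univ.filter (fun a : Fin n => a < k)) := by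
        ext a
        simp [le_iff_eq_or_lt]
      rw [← h1, Finset.sum_product, Finset.sum_mul]
      refine Finset.sum_congr rfl fun g hg => ?_
      have hgk : g k = k := (Finset.mem_filter.1 hg).2 k le_rfl
      rw [h2, Finset.sum_insert (by simp), Equiv.swap_self]
      have h3 : g * Equiv.refl (Fin n) = g := mul_one g
      rw [h3, mul_add, mul_one, jucysMurphy, Finset.smul_sum, Finset.mul_sum]
      congr 1
      refine Finset.sum_congr rfl fun a ha => ?_
      have hak : a ≠ k := ne_of_lt (Finset.mem_filter.1 ha).2
      rw [classLength_mul_swap hgk hak, MonoidAlgebra.smul_single, MonoidAlgebra.single_mul_single,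
        smul_eq_mul, mul_one, pow_succ]
  have h := key n le_rfl
  rw [List.take_of_length_le (by simp)] at h
  rw [elemJM, h]
  refine Finset.sum_congr ?_ fun _ _ => rfl
  ext g
  simp only [S, Finset.mem_filter, Finset.mem_univ, true_and, iff_true]
  intro b hb
  exact absurd b.2 (by omega)

/-- Not visible from the factors, since a single `𝒥_b` need not be central; Jucys' formula makes the
coefficients class functions. -/
theorem elemJM_mem_center (n : ℕ) (w : ℂ) : elemJM n w ∈ Subalgebra.center ℂ (GroupAlg n) := by
  rw [elemJM_eq_sum]
  exact sum_single_cyc_mem_center fun mu => w ^ classLength mu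

/-! ### The specialization `p_k = w ^ (k - 1)` and content products. -/

/-- The specialization `p_k ↦ w ^ (k - 1)`, with `w` the polynomial variable. -/
def contentSpec : MvPolynomial ℕ ℂ →ₐ[ℂ] Polynomial ℂ :=
  MvPolynomial.aeval fun k => Polynomial.X ^ (k - 1)

theorem contentSpec_powerSum {n : ℕ} (mu : n.Partition) :
    contentSpec (powerSum mu) = Polynomial.X ^ classLength mu := by
  rw [powerSum, classLength]
  induction mu.parts using Multiset.induction_on with
  | empty => simp
  | cons a s ih =>
    rw [Multiset.map_cons, Multiset.prod_cons, map_mul, ih, Multiset.map_cons, Multiset.sum_cons,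
      pow_add, contentSpec, MvPolynomial.aeval_X]

/-- `∏_{s < k} (y + s w) / k!`. -/
def risingPoly (y : Polynomial ℂ) (k : ℕ) : Polynomial ℂ :=
  Polynomial.C (1 / (k.factorial : ℂ)) *
    ∏ s ∈ Finset.range k, (y + (s : Polynomial ℂ) * Polynomial.X)

theorem succ_mul_risingPoly_succ (y : Polynomial ℂ) (k : ℕ) :
    ((k + 1 : ℕ) : Polynomial ℂ) * risingPoly y (k + 1) =
      (y + (k : Polynomial ℂ) * Polynomial.X) * risingPoly y k := by
  have h : ((k + 1 : ℕ) : Polynomial ℂ) * Polynomial.C (1 / ((k + 1).factorial : ℂ)) =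
      Polynomial.C (1 / (k.factorial : ℂ)) := by
    rw [← map_natCast (Polynomial.C : ℂ →+* Polynomial ℂ), ← map_mul]
    congr 1
    have h1 : (k.factorial : ℂ) ≠ 0 := Nat.cast_ne_zero.2 (Nat.factorial_pos k).ne'
    have h2 : ((k + 1 : ℕ) : ℂ) ≠ 0 := Nat.cast_ne_zero.2 (by omega)
    rw [Nat.factorial_succ, Nat.cast_mul]
    field_simp
  rw [risingPoly, risingPoly, Finset.prod_range_succ, ← mul_assoc, h]
  ring

/-- The two products of length `k + 1` share `k` factors; the remaining ones, `y + k w` and `y - w`,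
differ by `(k + 1) w`. This is the column operation used in `det_risingPolyInt`. -/
theorem risingPoly_sub (y : Polynomial ℂ) (k : ℕ) :
    risingPoly y (k + 1) = risingPoly (y - Polynomial.X) (k + 1) +
      Polynomial.X * risingPoly y k := by
  have hne : ((k + 1 : ℕ) : Polynomial ℂ) ≠ 0 := Nat.cast_ne_zero.2 (by omega)
  have h1 : ((k + 1 : ℕ) : Polynomial ℂ) * risingPoly (y - Polynomial.X) (k + 1) =
      (y - Polynomial.X) * risingPoly y k := by
    have h2 : ∏ s ∈ Finset.range (k + 1), (y - Polynomial.X + (s : Polynomial ℂ) * Polynomial.X) =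
        (y - Polynomial.X) * ∏ s ∈ Finset.range k, (y + (s : Polynomial ℂ) * Polynomial.X) := by
      rw [Finset.prod_range_succ', mul_comm]
      congr 1
      · simp
      · refine Finset.prod_congr rfl fun s _ => ?_
        push_cast
        ring
    have h3 : ((k + 1 : ℕ) : Polynomial ℂ) * Polynomial.C (1 / ((k + 1).factorial : ℂ)) =
        Polynomial.C (1 / (k.factorial : ℂ)) := by
      rw [← map_natCast (Polynomial.C : ℂ →+* Polynomial ℂ), ← map_mul]
      congr 1
      have h1 : (k.factorial : ℂ) ≠ 0 := Nat.cast_ne_zero.2 (Nat.factorial_pos k).ne'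
      have h2 : ((k + 1 : ℕ) : ℂ) ≠ 0 := Nat.cast_ne_zero.2 (by omega)
      rw [Nat.factorial_succ, Nat.cast_mul]
      field_simp
    rw [risingPoly, risingPoly, h2, ← mul_assoc, h3]
    ring
  refine mul_left_cancel₀ hne ?_
  rw [mul_add, h1, succ_mul_risingPoly_succ]
  push_cast
  ring

/-- The generating series becomes `(1 - w t) ^ (-1 / w)`, whose coefficients are rising factorials;
Newton's identity replaces the series. -/
theorem contentSpec_hsym (k : ℕ) : contentSpec (hsym k) = risingPoly 1 k := by
  have newton : ∀ k : ℕ, (k : Polynomial ℂ) * contentSpec (hsym k) =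
      ∑ j ∈ Finset.range k, Polynomial.X ^ j * contentSpec (hsym (k - (j + 1))) := by
    intro k
    have h := congrArg contentSpec (newton_hsym k)
    rw [map_mul, map_natCast, map_sum] at h
    rw [h]
    refine Finset.sum_congr rfl fun j _ => ?_
    rw [map_mul, contentSpec, MvPolynomial.aeval_X, Nat.add_sub_cancel]
  induction k with
  | zero => simp [hsym_zero, risingPoly]
  | succ k ih =>
    have hne : ((k + 1 : ℕ) : Polynomial ℂ) ≠ 0 := Nat.cast_ne_zero.2 (by omega)
    refine mul_left_cancel₀ hne ?_
    rw [succ_mul_risingPoly_succ, newton, Finset.sum_range_succ', ← ih]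
    have h : ∑ j ∈ Finset.range k, (Polynomial.X : Polynomial ℂ) ^ (j + 1) *
        contentSpec (hsym (k + 1 - (j + 1 + 1))) =
        Polynomial.X * ((k : Polynomial ℂ) * contentSpec (hsym k)) := by
      rw [newton, Finset.mul_sum]
      refine Finset.sum_congr rfl fun j _ => ?_
      rw [show k + 1 - (j + 1 + 1) = k - (j + 1) by omega]
      ring
    rw [h]
    simp
    ring

/-- `risingPoly` for integer indices, zero for negative ones. -/
def risingPolyInt (y : Polynomial ℂ) (k : ℤ) : Polynomial ℂ :=
  if 0 ≤ k then risingPoly y k.toNat else 0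

theorem risingPolyInt_natCast (y : Polynomial ℂ) (k : ℕ) :
    risingPolyInt y (k : ℤ) = risingPoly y k := by
  simp [risingPolyInt]

theorem risingPolyInt_of_neg (y : Polynomial ℂ) {k : ℤ} (hk : k < 0) : risingPolyInt y k = 0 := by
  rw [risingPolyInt, if_neg (not_le.2 hk)]

theorem contentSpec_completeSymm (k : ℤ) : contentSpec (completeSymm k) = risingPolyInt 1 k := by
  rcases lt_or_ge k 0 with hk | hk
  · rw [completeSymm_of_neg hk, risingPolyInt_of_neg _ hk, map_zero]
  · obtain ⟨m, rfl⟩ := Int.eq_ofNat_of_zero_le hk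
    rw [completeSymm_natCast, risingPolyInt_natCast, contentSpec_hsym]

theorem risingPolyInt_sub (y : Polynomial ℂ) (k : ℤ) :
    risingPolyInt y k = risingPolyInt (y - Polynomial.X) k +
      Polynomial.X * risingPolyInt y (k - 1) := by
  rcases lt_or_ge k 0 with hk | hk
  · rw [risingPolyInt_of_neg _ hk, risingPolyInt_of_neg _ hk, risingPolyInt_of_neg _ (by omega)]
    simp
  · obtain ⟨m, rfl⟩ := Int.eq_ofNat_of_zero_le hk
    rcases m with _ | m
    · rw [risingPolyInt_of_neg _ (show ((0 : ℕ) : ℤ) - 1 < 0 by simp), risingPolyInt_natCast,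
        risingPolyInt_natCast]
      simp [risingPoly]
    · have : ((m + 1 : ℕ) : ℤ) - 1 = (m : ℤ) := by push_cast; ring
      rw [this, risingPolyInt_natCast, risingPolyInt_natCast, risingPolyInt_natCast,
        risingPoly_sub]

theorem det_risingPolyInt {r : ℕ} (c : Fin r → ℤ) :
    (Matrix.of fun i j : Fin r => risingPolyInt 1 (c i + (j : ℤ))).det =
      (Matrix.of fun i j : Fin r =>
        risingPolyInt (1 - ((j : ℕ) : Polynomial ℂ) * Polynomial.X) (c i + (j : ℤ))).det := by
  rcases r with _ | r
  · simp
  · have key : ∀ t : ℕ, (Matrix.of fun i j : Fin (r + 1) =>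
          risingPolyInt 1 (c i + (j : ℤ))).det =
        (Matrix.of fun i j : Fin (r + 1) => risingPolyInt
          (1 - ((min (j : ℕ) t : ℕ) : Polynomial ℂ) * Polynomial.X) (c i + (j : ℤ))).det := by
      intro t
      induction t with
      | zero => simp
      | succ t ih =>
        rw [ih]
        refine Matrix.det_eq_of_forall_col_eq_smul_add_pred
          (fun j : Fin r => if t ≤ (j : ℕ) then Polynomial.X else 0) ?_ ?_
        · intro i
          simp
        · intro i j
          simp only [Matrix.of_apply, Fin.val_succ, Fin.val_castSucc]
          split_ifs with h
          · rw [min_eq_right (by omega), min_eq_right (by omega), min_eq_right h,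
              risingPolyInt_sub]
            congr 2
            · push_cast
              ring
            · congr 1
              push_cast
              ring
          · rw [min_eq_left (by omega), min_eq_left (by omega), zero_mul, add_zero]
    rw [key r]
    have h : ∀ j : Fin (r + 1), min (j : ℕ) r = j := fun j => min_eq_left (by omega)
    simp only [h]

/-- `∏_{s < m} (1 + (s - j) w)`. -/
def contentRow (j m : ℕ) : Polynomial ℂ :=
  ∏ s ∈ Finset.range m, (1 + ((s : Polynomial ℂ) - (j : Polynomial ℂ)) * Polynomial.X)

theorem contentRow_ne_zero (j m : ℕ) : contentRow j m ≠ 0 := by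
  refine Finset.prod_ne_zero_iff.2 fun s _ h => ?_
  have := congrArg (Polynomial.eval 0) h
  simp at this

/-- `contentRow j m` runs over the contents from `-j` to `m - j - 1`, so its ratio to `contentRow j
j` depends only on `m - j`. -/
theorem contentRow_mul {i j l m : ℕ} (h : l + j = m + i) :
    contentRow i i * contentRow j m = contentRow i l * contentRow j j := by
  rcases le_total j m with hjm | hjm
  · obtain ⟨e, rfl⟩ := Nat.exists_eq_add_of_le hjm
    obtain rfl : l = i + e := by omega
    have h1 : ∀ j : ℕ, contentRow j (j + e) = contentRow j j * contentRow 0 e := by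
      intro j
      rw [contentRow, Finset.prod_range_add]
      congr 1
      refine Finset.prod_congr rfl fun s _ => ?_
      push_cast
      ring
    rw [h1, h1]
    ring
  · obtain ⟨e, rfl⟩ := Nat.exists_eq_add_of_le hjm
    obtain rfl : i = l + e := by omega
    have h1 : ∀ m : ℕ, contentRow (m + e) (m + e) = contentRow (m + e) m * contentRow e e := by
      intro m
      nth_rewrite 1 [contentRow]
      rw [Finset.prod_range_add]
      congr 1
      refine Finset.prod_congr rfl fun s _ => ?_
      push_cast
      ring
    rw [h1, h1]
    ring

theorem risingPoly_one_sub (j m : ℕ) :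
    risingPoly (1 - (j : Polynomial ℂ) * Polynomial.X) m =
      Polynomial.C (1 / (m.factorial : ℂ)) * contentRow j m := by
  rw [risingPoly, contentRow]
  congr 1
  refine Finset.prod_congr rfl fun s _ => ?_
  ring

/-- `1 / k!`, zero for negative `k`. -/
def invFactorial (k : ℤ) : ℂ := if 0 ≤ k then 1 / (k.toNat.factorial : ℂ) else 0

theorem contentRow_mul_risingPolyInt (i j l : ℕ) :
    contentRow i i * risingPolyInt (1 - (j : Polynomial ℂ) * Polynomial.X)
        ((l : ℤ) - (i : ℤ) + (j : ℤ)) =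
      contentRow i l * (Polynomial.C (invFactorial ((l : ℤ) - (i : ℤ) + (j : ℤ))) *
        contentRow j j) := by
  rcases lt_or_ge ((l : ℤ) - (i : ℤ) + (j : ℤ)) 0 with hk | hk
  · rw [risingPolyInt_of_neg _ hk, invFactorial, if_neg (not_le.2 hk)]
    simp
  · obtain ⟨m, hm⟩ := Int.eq_ofNat_of_zero_le hk
    rw [hm, risingPolyInt_natCast, risingPoly_one_sub, invFactorial, if_pos (by omega),
      Int.toNat_natCast, mul_left_comm, contentRow_mul (show l + j = m + i by omega)]
    ring

/-- After the column operations the entry `(i, j)` is `contentRow j k / k!` with `k = λ_i - i + j`.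
Diagonal factors pull out of rows and columns, leaving the matrix of the `1 / k!`; its determinant
is `κ`, free of `w`. -/
theorem contentSpec_schur {n : ℕ} (lam : n.Partition) : ∃ κ : ℂ,
    contentSpec (schur lam) =
      (∏ i : Fin (rows lam).length, contentRow i ((rows lam).get i)) * Polynomial.C κ := by
  classical
  set r := (rows lam).length
  let F : Matrix (Fin r) (Fin r) ℂ :=
    Matrix.of fun i j => invFactorial (((rows lam).get i : ℤ) - (i : ℤ) + (j : ℤ))
  refine ⟨F.det, ?_⟩
  have h1 : contentSpec (schur lam) = (Matrix.of fun i j : Fin r =>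
      risingPolyInt (1 - ((j : ℕ) : Polynomial ℂ) * Polynomial.X)
        (((rows lam).get i : ℤ) - (i : ℤ) + (j : ℤ))).det := by
    rw [schur, AlgHom.map_det, ← det_risingPolyInt]
    congr 1
    ext1 i j
    exact contentSpec_completeSymm _
  set M : Matrix (Fin r) (Fin r) (Polynomial ℂ) := Matrix.of fun i j : Fin r =>
      risingPolyInt (1 - ((j : ℕ) : Polynomial ℂ) * Polynomial.X)
        (((rows lam).get i : ℤ) - (i : ℤ) + (j : ℤ)) with hM
  have h2 : Matrix.diagonal (fun i : Fin r => contentRow i i) * M =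
      Matrix.diagonal (fun i : Fin r => contentRow i ((rows lam).get i)) *
        (F.map Polynomial.C * Matrix.diagonal (fun i : Fin r => contentRow i i)) := by
    ext1 i j
    rw [Matrix.diagonal_mul, Matrix.diagonal_mul, Matrix.mul_diagonal]
    exact contentRow_mul_risingPolyInt _ _ _
  have h3 := congrArg Matrix.det h2
  have h4 : (F.map Polynomial.C).det = Polynomial.C F.det := (RingHom.map_det _ _).symm
  rw [Matrix.det_mul, Matrix.det_mul, Matrix.det_mul, Matrix.det_diagonal, Matrix.det_diagonal,
    h4] at h3
  have hne : ∏ i : Fin r, contentRow i i ≠ 0 :=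
    Finset.prod_ne_zero_iff.2 fun i _ => contentRow_ne_zero _ _
  rw [h1]
  refine mul_left_cancel₀ hne ?_
  rw [h3]
  ring

theorem eval_prod_contentRow {n : ℕ} (lam : n.Partition) (w : ℂ) :
    Polynomial.eval w (∏ i : Fin (rows lam).length, contentRow i ((rows lam).get i)) =
      contentProd lam fun c => 1 + w * (c : ℂ) := by
  rw [Polynomial.eval_prod, contentProd]
  refine Finset.prod_congr rfl fun i _ => ?_
  rw [contentRow, Polynomial.eval_prod, Finset.prod_range]
  refine Finset.prod_congr rfl fun j _ => ?_
  simp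
  ring

theorem sum_pow_classLength_mul_chi_div {n : ℕ} (lam : n.Partition) (w : ℂ) :
    ∑ mu : n.Partition, w ^ classLength mu * chi lam mu / zFactor mu =
      (contentProd lam fun c => 1 + w * (c : ℂ)) * (chi lam (cyc 1) / n.factorial) := by
  classical
  obtain ⟨κ, hκ⟩ := contentSpec_schur lam
  have h1 : ∀ w : ℂ, ∑ mu : n.Partition, w ^ classLength mu * chi lam mu / zFactor mu =
      (contentProd lam fun c => 1 + w * (c : ℂ)) * κ := by
    intro w
    rw [← eval_prod_contentRow, ← Polynomial.eval_C (x := w) (a := κ), ← Polynomial.eval_mul, ← hκ,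
      schur_eq_sum_chi, map_sum, Polynomial.eval_finsetSum]
    refine Finset.sum_congr rfl fun mu _ => ?_
    rw [map_smul, contentSpec_powerSum, Polynomial.eval_smul, Polynomial.eval_pow,
      Polynomial.eval_X, smul_eq_mul]
    ring
  -- At `w = 0` the content product is `1` and only the class of the identity, the one of length
  -- `0`, contributes.
  have h2 : κ = chi lam (cyc 1) / n.factorial := by
    have h3 := h1 0
    have h4 : (contentProd lam fun c => 1 + (0 : ℂ) * (c : ℂ)) = 1 := by
      simp [contentProd]
    rw [h4, one_mul] at h3
    rw [← h3, Finset.sum_eq_single (cyc 1)]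
    · rw [(classLength_cyc_eq_zero_iff 1).2 rfl, pow_zero, one_mul, zFactor_cyc_one]
    · intro mu _ hmu
      obtain ⟨g, rfl⟩ := cyc_surjective mu
      have : classLength (cyc g) ≠ 0 := by
        intro h
        exact hmu (by rw [(classLength_cyc_eq_zero_iff g).1 h])
      rw [zero_pow this]
      simp
    · simp
  rw [h1, h2]

/-! ### Eigenvalues on the idempotents. -/

/-- The eigenvalue of `E(w, 𝒥)` on `F_λ`. -/
theorem elemJM_mul_idem {n : ℕ} (w : ℂ) (lam : n.Partition) :
    elemJM n w * idem lam = (contentProd lam fun c => 1 + w * (c : ℂ)) • idem lam := by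
  rw [center_mul_idem lam (elemJM_mem_center n w)]
  congr 1
  rw [div_eq_iff (chi_one_ne_zero lam)]
  have hn : (n.factorial : ℂ) ≠ 0 := Nat.cast_ne_zero.2 (Nat.factorial_pos n).ne'
  have h1 : ∀ g, (elemJM n w).coeff g * chi lam (cyc g) =
      w ^ classLength (cyc g) * chi lam (cyc g) := by
    intro g
    rw [elemJM_eq_sum, coeff_sum_single]
  rw [Finset.sum_congr rfl fun g _ => h1 g, sum_cyc fun mu => w ^ classLength mu * chi lam mu]
  have h2 := sum_pow_classLength_mul_chi_div lam w
  have h3 : ∑ mu : n.Partition, ((n.factorial : ℂ) / zFactor mu) •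
      (w ^ classLength mu * chi lam mu) =
      n.factorial * ∑ mu : n.Partition, w ^ classLength mu * chi lam mu / zFactor mu := by
    rw [Finset.mul_sum]
    exact Finset.sum_congr rfl fun mu _ => by rw [smul_eq_mul]; ring
  rw [h3, h2]
  field_simp

theorem prod_elemJM_mul_idem {m n : ℕ} (w : Fin m → ℂ) (lam : n.Partition) :
    (List.ofFn fun α => elemJM n (w α)).prod * idem lam =
      (∏ α, contentProd lam fun c => 1 + w α * (c : ℂ)) • idem lam := by
  induction m with
  | zero => simp
  | succ m ih =>
    rw [List.ofFn_succ, List.prod_cons, mul_assoc, ih (fun α => w α.succ), mul_smul_comm,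
      elemJM_mul_idem, smul_smul, Fin.prod_univ_succ, mul_comm]

/-! ### Monotone segments of transpositions. -/

/-- A monotone segment: `k` transpositions `(aᵢ bᵢ)`, `aᵢ < bᵢ`, with strictly increasing `bᵢ`. -/
def IsSegment {n k : ℕ} (p : (Fin k → Fin n) × (Fin k → Fin n)) : Prop :=
  (∀ i, p.1 i < p.2 i) ∧ StrictMono p.2

/-- The product `(a₁ b₁) ⋯ (a_k b_k)`. -/
def swapProd {n k : ℕ} (p : (Fin k → Fin n) × (Fin k → Fin n)) : Equiv.Perm (Fin n) :=
  (List.ofFn fun i => Equiv.swap (p.1 i) (p.2 i)).prod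

theorem swapProd_snoc {n k : ℕ} (p : (Fin k → Fin n) × (Fin k → Fin n)) (a b : Fin n) :
    swapProd (Fin.snoc (α := fun _ => Fin n) p.1 a, Fin.snoc (α := fun _ => Fin n) p.2 b) =
      swapProd p * Equiv.swap a b := by
  rw [swapProd, List.ofFn_succ', List.concat_eq_append, List.prod_append, List.prod_singleton]
  simp [swapProd]

open Classical in
/-- The monotone segments of length `k` with all `bᵢ < t`. -/
def segmentsBelow (n t k : ℕ) : Finset ((Fin k → Fin n) × (Fin k → Fin n)) :=
  Finset.univ.filter fun p => IsSegment p ∧ ∀ i, (p.2 i : ℕ) < t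

theorem mem_segmentsBelow {n t k : ℕ} {p : (Fin k → Fin n) × (Fin k → Fin n)} :
    p ∈ segmentsBelow n t k ↔ IsSegment p ∧ ∀ i, (p.2 i : ℕ) < t := by
  simp [segmentsBelow]

/-- The sum in the group algebra of the products of the segments with all `bᵢ < t`. -/
def segmentSum (n t k : ℕ) : GroupAlg n :=
  ∑ p ∈ segmentsBelow n t k, MonoidAlgebra.single (swapProd p) 1

theorem le_of_mem_segmentsBelow {n t k : ℕ} {p : (Fin k → Fin n) × (Fin k → Fin n)}
    (hp : p ∈ segmentsBelow n t k) : k ≤ t := by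
  rw [mem_segmentsBelow] at hp
  have h : Function.Injective fun i : Fin k => (⟨(p.2 i : ℕ), hp.2 i⟩ : Fin t) := by
    intro i j hij
    exact hp.1.2.injective (Fin.ext (Fin.mk.inj_iff.1 hij))
  simpa using Fintype.card_le_of_injective _ h

theorem segmentSum_of_lt {n t k : ℕ} (h : t < k) : segmentSum n t k = 0 := by
  refine Finset.sum_eq_zero fun p hp => ?_
  exact absurd (le_of_mem_segmentsBelow hp) (not_le.2 h)

theorem segmentSum_zero (n t : ℕ) : segmentSum n t 0 = 1 := by
  have h : segmentsBelow n t 0 = {(Fin.elim0, Fin.elim0)} := by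
    ext p
    simp [mem_segmentsBelow, IsSegment, StrictMono, eq_iff_true_of_subsingleton]
  rw [segmentSum, h, MonoidAlgebra.one_def, Finset.sum_singleton]
  simp [swapProd]

/-- Either all `b`'s stay below `t`, or the last one equals `t` and the last transposition is a
summand of `𝒥_t`, standing on the right. -/
theorem segmentSum_succ {n t k : ℕ} (ht : t < n) : segmentSum n (t + 1) (k + 1) =
    segmentSum n t (k + 1) + segmentSum n t k * jucysMurphy (⟨t, ht⟩ : Fin n) := by
  classical
  rw [segmentSum, ← Finset.sum_filter_add_sum_filter_not _
    (fun p : (Fin (k + 1) → Fin n) × (Fin (k + 1) → Fin n) => (p.2 (Fin.last k) : ℕ) < t)]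
  congr 1
  · refine Finset.sum_congr ?_ fun _ _ => rfl
    ext p
    rw [Finset.mem_filter, mem_segmentsBelow, mem_segmentsBelow]
    constructor
    · rintro ⟨⟨h1, h2⟩, h3⟩
      exact ⟨h1, fun i => lt_of_le_of_lt (h1.2.monotone (Fin.le_last i)) h3⟩
    · rintro ⟨h1, h2⟩
      exact ⟨⟨h1, fun i => (h2 i).trans (Nat.lt_succ_self t)⟩, h2 _⟩
  · rw [segmentSum, jucysMurphy, Finset.sum_mul_sum, ← Finset.sum_product']
    symm
    refine Finset.sum_nbij' (fun x => (Fin.snoc (α := fun _ => Fin n) x.1.1 x.2,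
        Fin.snoc (α := fun _ => Fin n) x.1.2 ⟨t, ht⟩))
      (fun p => ((fun i => p.1 i.castSucc, fun i => p.2 i.castSucc), p.1 (Fin.last k)))
      ?_ ?_ ?_ ?_ ?_
    · rintro ⟨p, a⟩ hx
      rw [Finset.mem_product, mem_segmentsBelow, Finset.mem_filter] at hx
      obtain ⟨⟨⟨h1, h2⟩, h3⟩, -, h4⟩ := hx
      rw [Finset.mem_filter, mem_segmentsBelow]
      refine ⟨⟨⟨fun i => ?_, ?_⟩, fun i => ?_⟩, by simp⟩
      · induction i using Fin.lastCases with
        | last => simpa using h4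
        | cast i => simpa using h1 i
      · intro i j hij
        induction j using Fin.lastCases with
        | last =>
          induction i using Fin.lastCases with
          | last => exact absurd hij (lt_irrefl _)
          | cast i =>
            simp only [Fin.snoc_castSucc, Fin.snoc_last]
            exact h3 i
        | cast j =>
          induction i using Fin.lastCases with
          | last => exact absurd hij (not_lt.2 (Fin.le_last _))
          | cast i =>
            simp only [Fin.snoc_castSucc]
            exact h2 (Fin.castSucc_lt_castSucc_iff.1 hij)
      · induction i using Fin.lastCases with
        | last => simp
        | cast i =>
          simp only [Fin.snoc_castSucc]
          exact (h3 i).trans (Nat.lt_succ_self t)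
    · intro p hp
      rw [Finset.mem_filter, mem_segmentsBelow] at hp
      obtain ⟨⟨⟨h1, h2⟩, h3⟩, h4⟩ := hp
      have h5 : (p.2 (Fin.last k) : ℕ) = t := by
        have := h3 (Fin.last k)
        omega
      rw [Finset.mem_product, mem_segmentsBelow, Finset.mem_filter]
      refine ⟨⟨⟨fun i => h1 _, fun i j hij => h2 (Fin.castSucc_lt_castSucc_iff.2 hij)⟩,
        fun i => ?_⟩, Finset.mem_univ _, ?_⟩
      · rw [← h5]
        exact h2 (Fin.castSucc_lt_last i)
      · have h6 : p.2 (Fin.last k) = ⟨t, ht⟩ := Fin.ext h5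
        rw [← h6]
        exact h1 _
    · rintro ⟨p, a⟩ _
      simp
    · intro p hp
      rw [Finset.mem_filter, mem_segmentsBelow] at hp
      have h5 : p.2 (Fin.last k) = ⟨t, ht⟩ := by
        have := hp.1.2 (Fin.last k)
        exact Fin.ext (by simp; omega)
      refine Prod.ext ?_ ?_
      · funext i
        induction i using Fin.lastCases <;> simp
      · funext i
        induction i using Fin.lastCases <;> simp [h5]
    · rintro ⟨p, a⟩ _
      simp only
      rw [swapProd_snoc, MonoidAlgebra.single_mul_single, mul_one]

/-- The recursion `segmentSum_succ` is that of elementary symmetric polynomials in the ordered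
`𝒥_b`. Lengths beyond `n` do not occur, as the `b`'s are distinct. -/
theorem elemJM_eq_sum_segmentSum (n : ℕ) (w : ℂ) :
    elemJM n w = ∑ k ∈ Finset.range (n + 1), w ^ k • segmentSum n n k := by
  have key : ∀ t ≤ n, ((List.ofFn fun b : Fin n => 1 + w • jucysMurphy b).take t).prod =
      ∑ k ∈ Finset.range (t + 1), w ^ k • segmentSum n t k := by
    intro t ht
    induction t with
    | zero => simp [segmentSum_zero]
    | succ t ih =>
      rw [List.prod_take_succ _ _ (by simpa using ht), ih (by omega), List.getElem_ofFn]
      rw [Finset.sum_range_succ' _ (t + 1), pow_zero, one_smul, segmentSum_zero]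
      simp only [segmentSum_succ (show t < n from ht), smul_add, Finset.sum_add_distrib]
      have h1 := Finset.sum_range_succ' (fun k => w ^ k • segmentSum n t k) (t + 1)
      rw [Finset.sum_range_succ, segmentSum_of_lt (Nat.lt_succ_self t), smul_zero, add_zero,
        pow_zero, one_smul, segmentSum_zero] at h1
      rw [add_right_comm, ← h1, mul_add, mul_one, Finset.sum_mul]
      congr 1
      refine Finset.sum_congr rfl fun k _ => ?_
      rw [smul_mul_smul_comm, pow_succ]
  have h := key n le_rfl
  rwa [List.take_of_length_le (by simp)] at h

/-- The type of monotone segments of length `k`. -/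
abbrev Segment (n k : ℕ) : Type := {p : (Fin k → Fin n) × (Fin k → Fin n) // IsSegment p}

open Classical in
theorem segmentSum_eq_sum_segment (n k : ℕ) :
    segmentSum n n k = ∑ p : Segment n k, MonoidAlgebra.single (swapProd p.1) 1 := by
  rw [segmentSum]
  refine Finset.sum_subtype _ (fun p => ?_) _
  rw [mem_segmentsBelow]
  exact and_iff_left fun i => (p.2 i).2

theorem prod_ofFn_sum {A : Type*} [Semiring A] {m : ℕ} {T : Fin m → Type*} [∀ α, Fintype (T α)]
    (f : (α : Fin m) → T α → A) :
    (List.ofFn fun α => ∑ x, f α x).prod =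
      ∑ p : (α : Fin m) → T α, (List.ofFn fun α => f α (p α)).prod := by
  induction m with
  | zero => simp
  | succ m ih =>
    rw [List.ofFn_succ, List.prod_cons, ih (fun α => f α.succ), Finset.sum_mul_sum,
      ← Fintype.sum_prod_type']
    refine Fintype.sum_equiv (Fin.consEquiv T) _ _ fun x => ?_
    rw [List.ofFn_succ, List.prod_cons]
    simp [Fin.consEquiv]

theorem prod_ofFn_smul {A : Type*} [Semiring A] [Algebra ℂ A] {m : ℕ} (c : Fin m → ℂ)
    (x : Fin m → A) :
    (List.ofFn fun α => c α • x α).prod = (∏ α, c α) • (List.ofFn x).prod := by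
  induction m with
  | zero => simp
  | succ m ih =>
    rw [List.ofFn_succ, List.prod_cons, ih (fun α => c α.succ), List.ofFn_succ, List.prod_cons,
      smul_mul_smul_comm, Fin.prod_univ_succ]

theorem prod_ofFn_single {n m : ℕ} (g : Fin m → Equiv.Perm (Fin n)) :
    (List.ofFn fun α => (MonoidAlgebra.single (g α) 1 : GroupAlg n)).prod =
      MonoidAlgebra.single (List.ofFn g).prod 1 := by
  have h := map_list_prod (MonoidAlgebra.of ℂ (Equiv.Perm (Fin n))) (List.ofFn g)
  rw [List.map_ofFn] at h
  exact h.symm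

open Classical in
theorem prod_elemJM_eq_sum {m : ℕ} (n : ℕ) (w : Fin m → ℂ) :
    (List.ofFn fun α => elemJM n (w α)).prod =
      ∑ d : Fin m → Fin (n + 1), (∏ α, w α ^ (d α : ℕ)) •
        ∑ p : (α : Fin m) → Segment n (d α),
          MonoidAlgebra.single (List.ofFn fun α => swapProd (p α).1).prod 1 := by
  simp only [elemJM_eq_sum_segmentSum, Finset.sum_range]
  rw [prod_ofFn_sum (T := fun _ => Fin (n + 1))
    (fun α k => w α ^ (k : ℕ) • segmentSum n n (k : ℕ))]
  refine Finset.sum_congr rfl fun d _ => ?_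
  rw [prod_ofFn_smul]
  congr 1
  simp only [segmentSum_eq_sum_segment]
  rw [prod_ofFn_sum (T := fun α => Segment n (d α))
    (fun α p => (MonoidAlgebra.single (swapProd p.1) 1 : GroupAlg n))]
  exact Finset.sum_congr rfl fun p _ => prod_ofFn_single _

/-! ### Counting paths between conjugacy classes. -/

/-- The sum of the coefficients of `x` at the `h g⁻¹`, where `g`, `h` run over two classes. -/
def classPairing {n : ℕ} (lam mu : n.Partition) : GroupAlg n →ₗ[ℂ] ℂ where
  toFun x := ∑ g ∈ Finset.univ.filter fun g : Equiv.Perm (Fin n) => cyc g = lam,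
    ∑ h ∈ Finset.univ.filter fun h : Equiv.Perm (Fin n) => cyc h = mu, x.coeff (h * g⁻¹)
  map_add' x y := by
    simp only [MonoidAlgebra.coeff_add, Finsupp.add_apply, Finset.sum_add_distrib]
  map_smul' c x := by
    simp only [MonoidAlgebra.coeff_smul, Finsupp.smul_apply, ← Finset.smul_sum, RingHom.id_apply]

theorem classPairing_single {n : ℕ} (lam mu : n.Partition) (y : Equiv.Perm (Fin n)) :
    classPairing lam mu (MonoidAlgebra.single y 1) =
      Nat.card {g : Equiv.Perm (Fin n) // cyc g = lam ∧ cyc (y * g) = mu} := by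
  classical
  have h1 : ∀ g h : Equiv.Perm (Fin n), y = h * g⁻¹ ↔ y * g = h := fun g h =>
    eq_mul_inv_iff_mul_eq
  have h2 : ∀ g : Equiv.Perm (Fin n),
      ∑ h ∈ Finset.univ.filter (fun h : Equiv.Perm (Fin n) => cyc h = mu),
        (MonoidAlgebra.single y 1 : GroupAlg n).coeff (h * g⁻¹) =
      if cyc (y * g) = mu then 1 else 0 := by
    intro g
    simp only [MonoidAlgebra.coeff_single, Finsupp.single_apply, h1]
    rw [Finset.sum_ite_eq]
    simp
  have h3 : classPairing lam mu (MonoidAlgebra.single y 1) =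
      ∑ g ∈ Finset.univ.filter (fun g : Equiv.Perm (Fin n) => cyc g = lam),
        if cyc (y * g) = mu then (1 : ℂ) else 0 :=
    Finset.sum_congr rfl fun g _ => h2 g
  rw [h3, ← Finset.sum_filter, Finset.filter_filter, Finset.sum_const, nsmul_eq_mul, mul_one,
    Nat.card_eq_fintype_card, Fintype.card_subtype]

/-- A path is the choice of its segments and of its source. -/
def pathEquiv {m n : ℕ} (d : Fin m → ℕ) (lam mu : n.Partition) :
    MultimonotonePath d lam mu ≃ Σ p : (α : Fin m) → Segment n (d α),
      {g : Equiv.Perm (Fin n) //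
        cyc g = lam ∧ cyc ((List.ofFn fun α => swapProd (p α).1).prod * g) = mu} where
  toFun P := ⟨fun α => ⟨(P.a α, P.b α), P.a_lt_b α, P.strictMono_b α⟩, P.source, P.cyc_source, by
    have h := P.cyc_target
    rw [P.target_eq] at h
    exact h⟩
  invFun x :=
    { source := x.2.1
      target := (List.ofFn fun α => swapProd (x.1 α).1).prod * x.2.1
      a := fun α => (x.1 α).1.1
      b := fun α => (x.1 α).1.2
      a_lt_b := fun α => (x.1 α).2.1
      strictMono_b := fun α => (x.1 α).2.2
      cyc_source := x.2.2.1
      cyc_target := x.2.2.2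
      target_eq := rfl }
  left_inv P := by
    ext1
    · rfl
    · exact P.target_eq.symm
    · rfl
    · rfl
  right_inv _ := rfl

open Classical in
theorem factorial_mul_E {m n : ℕ} (d : Fin m → ℕ) (lam mu : n.Partition) :
    (n.factorial : ℂ) * E d lam mu = classPairing lam mu
      (∑ p : (α : Fin m) → Segment n (d α),
        MonoidAlgebra.single (List.ofFn fun α => swapProd (p α).1).prod 1) := by
  have hn : (n.factorial : ℂ) ≠ 0 := Nat.cast_ne_zero.2 (Nat.factorial_pos n).ne'
  rw [E, mul_div_cancel₀ _ hn, Nat.card_congr (pathEquiv d lam mu), Nat.card_sigma, map_sum,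
    Nat.cast_sum]
  exact Finset.sum_congr rfl fun p _ => (classPairing_single _ _ _).symm

theorem E_eq_zero {m n : ℕ} {d : Fin m → ℕ} (lam mu : n.Partition) {α : Fin m} (h : n < d α) :
    E d lam mu = 0 := by
  have : IsEmpty (MultimonotonePath d lam mu) := by
    refine ⟨fun P => ?_⟩
    have := Fintype.card_le_of_injective _ (P.strictMono_b α).injective
    simp at this
    omega
  rw [E, Nat.card_of_isEmpty, Nat.cast_zero, zero_div]

/-- The inner sum over `g` is a coefficient of `F_ν` times the class sum `K` of `λ`. As `K` is
central it acts on `F_ν` by a scalar, and the class of `μ` then adds equal terms. -/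
theorem classPairing_idem {n : ℕ} (nu lam mu : n.Partition) :
    classPairing lam mu (idem nu) =
      n.factorial * (chi nu lam / zFactor lam) * (chi nu mu / zFactor mu) := by
  classical
  let K : GroupAlg n := ∑ g : Equiv.Perm (Fin n),
    MonoidAlgebra.single g (if cyc g = lam then 1 else 0)
  have hK : K ∈ Subalgebra.center ℂ (GroupAlg n) :=
    sum_single_cyc_mem_center fun nu => if nu = lam then 1 else 0
  have h1 : ∀ h : Equiv.Perm (Fin n), (idem nu * K).coeff h =
      ∑ g ∈ Finset.univ.filter (fun g : Equiv.Perm (Fin n) => cyc g = lam),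
        (idem nu).coeff (h * g⁻¹) := by
    intro h
    rw [Finset.mul_sum, MonoidAlgebra.coeff_sum, Finsupp.finsetSum_apply, Finset.sum_filter]
    refine Finset.sum_congr rfl fun g _ => ?_
    rw [MonoidAlgebra.coeff_mul_single_apply, mul_ite, mul_one, mul_zero]
  have hn : (n.factorial : ℂ) ≠ 0 := Nat.cast_ne_zero.2 (Nat.factorial_pos n).ne'
  have h2 : ∑ g, K.coeff g * chi nu (cyc g) = n.factorial / zFactor lam * chi nu lam := by
    have h3 : ∀ g, K.coeff g * chi nu (cyc g) = if cyc g = lam then chi nu lam else 0 := by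
      intro g
      rw [coeff_sum_single]
      split_ifs with h
      · rw [h, one_mul]
      · rw [zero_mul]
    rw [Finset.sum_congr rfl fun g _ => h3 g, ← Finset.sum_filter, Finset.sum_const, nsmul_eq_mul,
      card_cyc_eq]
  have h4 : classPairing lam mu (idem nu) =
      ∑ h ∈ Finset.univ.filter (fun h : Equiv.Perm (Fin n) => cyc h = mu),
        (idem nu * K).coeff h := by
    rw [Finset.sum_congr rfl fun h _ => h1 h, Finset.sum_comm]
    rfl
  rw [h4, Subalgebra.mem_center_iff.1 hK, center_mul_idem nu hK, h2]
  have h5 : ∀ h ∈ Finset.univ.filter (fun h : Equiv.Perm (Fin n) => cyc h = mu),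
      ((n.factorial / zFactor lam * chi nu lam / chi nu (cyc 1)) • idem nu).coeff h =
        chi nu lam / zFactor lam * chi nu mu := by
    intro h hh
    rw [MonoidAlgebra.coeff_smul_apply, coeff_idem, (Finset.mem_filter.1 hh).2, smul_eq_mul]
    have := chi_one_ne_zero nu
    field_simp
  rw [Finset.sum_congr rfl h5, Finset.sum_const, nsmul_eq_mul, card_cyc_eq]
  ring

/-- The generating function of multimonotone paths in terms of characters. -/
theorem sum_pow_mul_E {m n : ℕ} (w : Fin m → ℂ) (lam mu : n.Partition) :
    ∑ d : Fin m → Fin (n + 1), (∏ α, w α ^ (d α : ℕ)) * E (fun α => (d α : ℕ)) lam mu =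
      ∑ nu : n.Partition, (∏ α, contentProd nu fun c => 1 + w α * (c : ℂ)) *
        ((chi nu lam / zFactor lam) * (chi nu mu / zFactor mu)) := by
  classical
  have hn : (n.factorial : ℂ) ≠ 0 := Nat.cast_ne_zero.2 (Nat.factorial_pos n).ne'
  refine mul_left_cancel₀ hn ?_
  -- One side lists segments and so counts paths; the other, after inserting `1 = ∑ F_ν`, is
  -- diagonal.
  have h1 := congrArg (classPairing lam mu) (prod_elemJM_eq_sum n w)
  have h2 : (List.ofFn fun α => elemJM n (w α)).prod =
      ∑ nu : n.Partition, (∏ α, contentProd nu fun c => 1 + w α * (c : ℂ)) • idem nu := by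
    conv_lhs => rw [← mul_one (List.ofFn fun α => elemJM n (w α)).prod, ← sum_idem, Finset.mul_sum]
    exact Finset.sum_congr rfl fun nu _ => prod_elemJM_mul_idem w nu
  rw [h2, map_sum, map_sum] at h1
  simp only [map_smul, ← factorial_mul_E, classPairing_idem, smul_eq_mul] at h1
  rw [Finset.mul_sum, Finset.mul_sum]
  calc _ = _ := Finset.sum_congr rfl fun d _ => by ring
    _ = _ := h1.symm
    _ = _ := Finset.sum_congr rfl fun nu _ => by ring

/-! ### Coefficientwise convergence and the path expansion. -/

theorem twoSets_sum_sum {ι κ : Type*} (s : Finset ι) (t : Finset κ) (a : ι → ℂ) (b : κ → ℂ)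
    (f : ι → MvPolynomial ℕ ℂ) (g : κ → MvPolynomial ℕ ℂ) :
    twoSets (∑ i ∈ s, a i • f i) (∑ j ∈ t, b j • g j) =
      ∑ i ∈ s, ∑ j ∈ t, (a i * b j) • twoSets (f i) (g j) := by
  simp only [twoSets, map_sum, Finset.sum_mul_sum, map_smul, smul_mul_smul_comm]
  have h : ∀ p : MvPolynomial (ℕ ⊕ ℕ) ℂ, (p : MvPowerSeries (ℕ ⊕ ℕ) ℂ) =
      MvPolynomial.coeToMvPowerSeries.algHom ℂ p := by
    intro p
    simp
  simp only [h, map_sum, map_smul]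

/-- The weight of a monomial in the first set of variables. -/
def leftWeight (e : ℕ ⊕ ℕ →₀ ℕ) : ℕ := e.sum fun i c => Sum.elim (fun k => k * c) (fun _ => 0) i

theorem leftWeight_add (e f : ℕ ⊕ ℕ →₀ ℕ) : leftWeight (e + f) = leftWeight e + leftWeight f := by
  refine Finsupp.sum_add_index' ?_ ?_
  · rintro (i | i) <;> simp
  · rintro (i | i) a b <;> simp [mul_add]

theorem coeff_twoSets_powerSum {n : ℕ} (mu nu : n.Partition) {e : ℕ ⊕ ℕ →₀ ℕ}
    (he : leftWeight e ≠ n) : MvPowerSeries.coeff e (twoSets (powerSum mu) (powerSum nu)) = 0 := by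
  classical
  rw [twoSets, MvPolynomial.coeff_coe, powerSum_eq_monomial, powerSum_eq_monomial,
    MvPolynomial.rename_monomial, MvPolynomial.rename_monomial, MvPolynomial.monomial_mul,
    MvPolynomial.coeff_monomial, if_neg]
  rintro rfl
  apply he
  have h1 : leftWeight (Finsupp.mapDomain Sum.inr (Multiset.toFinsupp nu.parts)) = 0 := by
    rw [leftWeight, Finsupp.sum_mapDomain_index_inj Sum.inr_injective]
    simp
  have h2 : leftWeight (Finsupp.mapDomain Sum.inl (Multiset.toFinsupp mu.parts)) = n := by
    rw [leftWeight, Finsupp.sum_mapDomain_index_inj Sum.inl_injective]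
    simp only [Sum.elim_inl, Finsupp.sum, Multiset.toFinsupp_support, Multiset.toFinsupp_apply]
    conv_rhs => rw [← mu.parts_sum, Finset.sum_multiset_count]
    refine Finset.sum_congr (by ext; simp) fun i _ => ?_
    rw [smul_eq_mul, mul_comm]
  rw [leftWeight_add, h1, h2, add_zero]

theorem twoSets_schur {n : ℕ} (lam : n.Partition) : twoSets (schur lam) (schur lam) =
    ∑ mu : n.Partition, ∑ nu : n.Partition,
      (chi lam mu / zFactor mu * (chi lam nu / zFactor nu)) •
        twoSets (powerSum mu) (powerSum nu) := by
  rw [schur_eq_sum_chi, twoSets_sum_sum]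

theorem coeff_twoSets_schur {n : ℕ} (lam : n.Partition) {e : ℕ ⊕ ℕ →₀ ℕ}
    (he : leftWeight e ≠ n) : MvPowerSeries.coeff e (twoSets (schur lam) (schur lam)) = 0 := by
  rw [twoSets_schur, map_sum]
  refine Finset.sum_eq_zero fun mu _ => ?_
  rw [map_sum]
  refine Finset.sum_eq_zero fun nu _ => ?_
  rw [map_smul, coeff_twoSets_powerSum mu nu he, smul_zero]

/-- Convergence is tested monomial by monomial, and a monomial `e` only sees the level `n =
leftWeight e`. The first set of variables suffices to detect the level. -/
theorem hasSum_of_leftWeight {T : ℕ → Type*} {F : (Σ n, T n) → MvPowerSeries (ℕ ⊕ ℕ) ℂ}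
    {G : ℕ → MvPowerSeries (ℕ ⊕ ℕ) ℂ} (hF : ∀ n, HasSum (fun t : T n => F ⟨n, t⟩) (G n))
    (h0 : ∀ n (t : T n) (e : ℕ ⊕ ℕ →₀ ℕ), leftWeight e ≠ n →
      MvPowerSeries.coeff e (F ⟨n, t⟩) = 0) :
    HasSum F fun e => MvPowerSeries.coeff e (G (leftWeight e)) := by
  refine Pi.hasSum.2 fun e => ?_
  have h1 : HasSum (fun t : T (leftWeight e) => F ⟨leftWeight e, t⟩ e) (G (leftWeight e) e) :=
    Pi.hasSum.1 (hF (leftWeight e)) e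
  refine (Function.Injective.hasSum_iff (sigma_mk_injective (i := leftWeight e)) ?_).1 h1
  rintro ⟨n, t⟩ hx
  refine h0 n t e ?_
  rintro rfl
  exact hx ⟨t, rfl⟩

theorem hasSum_schur {m : ℕ} (q : ℂ) (w : Fin m → ℂ) :
    HasSum (fun l : (Σ n : ℕ, n.Partition) => rTilde q w l.2 •
        twoSets (schur l.2) (schur l.2))
      (fun e => MvPowerSeries.coeff e (∑ lam : (leftWeight e).Partition,
        rTilde q w lam • twoSets (schur lam) (schur lam))) := by
  refine hasSum_of_leftWeight
    (G := fun n => ∑ lam : n.Partition, rTilde q w lam • twoSets (schur lam) (schur lam))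
    (fun n => hasSum_fintype _) fun n lam e he => ?_
  rw [map_smul, coeff_twoSets_schur lam he, smul_zero]

theorem ZTilde_eq {m : ℕ} (q : ℂ) (w : Fin m → ℂ) : ZTilde q w =
    fun e => MvPowerSeries.coeff e (∑ lam : (leftWeight e).Partition,
        rTilde q w lam • twoSets (schur lam) (schur lam)) :=
  (hasSum_schur q w).tsum_eq

theorem hasSum_ZTilde {m : ℕ} (q : ℂ) (w : Fin m → ℂ) :
    HasSum (fun l : (Σ n : ℕ, n.Partition) => rTilde q w l.2 •
        twoSets (schur l.2) (schur l.2)) (ZTilde q w) := by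
  rw [ZTilde_eq]
  exact hasSum_schur q w

theorem sum_rTilde_eq {m : ℕ} (n : ℕ) (q : ℂ) (w : Fin m → ℂ) :
    ∑ lam : n.Partition, rTilde q w lam • twoSets (schur lam) (schur lam) =
      ∑ lam : n.Partition, ∑ mu : n.Partition, ∑ d : Fin m → Fin (n + 1),
        (q ^ n * (∏ α, w α ^ (d α : ℕ)) * E (fun α => (d α : ℕ)) lam mu) •
          twoSets (powerSum lam) (powerSum mu) := by
  have h1 : ∀ lam mu : n.Partition, ∑ d : Fin m → Fin (n + 1),
        (q ^ n * (∏ α, w α ^ (d α : ℕ)) * E (fun α => (d α : ℕ)) lam mu) •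
          twoSets (powerSum lam) (powerSum mu) =
      ∑ nu : n.Partition, (rTilde q w nu *
        ((chi nu lam / zFactor lam) * (chi nu mu / zFactor mu))) •
          twoSets (powerSum lam) (powerSum mu) := by
    intro lam mu
    rw [← Finset.sum_smul, ← Finset.sum_smul]
    congr 1
    simp only [mul_assoc, ← Finset.mul_sum, rTilde]
    rw [sum_pow_mul_E]
  simp only [h1, twoSets_schur, Finset.smul_sum, smul_smul]
  rw [Finset.sum_comm]
  exact Finset.sum_congr rfl fun mu _ => Finset.sum_comm

theorem hasSum_paths {m : ℕ} (q : ℂ) (w : Fin m → ℂ) :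
    HasSum (fun k : (Σ n : ℕ, n.Partition × n.Partition × (Fin m → ℕ)) =>
        (q ^ k.1 * (∏ α, w α ^ k.2.2.2 α) * E k.2.2.2 k.2.1 k.2.2.1) •
          twoSets (powerSum k.2.1) (powerSum k.2.2.1)) (ZTilde q w) := by
  classical
  rw [ZTilde_eq]
  refine hasSum_of_leftWeight
    (T := fun n => n.Partition × n.Partition × (Fin m → ℕ))
    (G := fun n => ∑ lam : n.Partition, rTilde q w lam • twoSets (schur lam) (schur lam))
    (fun n => ?_) ?_
  · let s : Finset (Fin m → ℕ) :=
      Finset.univ.image fun d : Fin m → Fin (n + 1) => fun α => (d α : ℕ)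
    have hs : ∀ f : (Fin m → ℕ) → MvPowerSeries (ℕ ⊕ ℕ) ℂ,
        ∑ d ∈ s, f d = ∑ d : Fin m → Fin (n + 1), f fun α => (d α : ℕ) := by
      intro f
      refine Finset.sum_image fun d _ d' _ h => ?_
      funext α
      exact Fin.ext (congrFun h α)
    rw [sum_rTilde_eq]
    have h3 : ∑ lam : n.Partition, ∑ mu : n.Partition, ∑ d : Fin m → Fin (n + 1),
        (q ^ n * (∏ α, w α ^ (d α : ℕ)) * E (fun α => (d α : ℕ)) lam mu) •
          twoSets (powerSum lam) (powerSum mu) =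
        ∑ lam : n.Partition, ∑ mu : n.Partition, ∑ d ∈ s,
        (q ^ n * (∏ α, w α ^ d α) * E d lam mu) • twoSets (powerSum lam) (powerSum mu) :=
      Finset.sum_congr rfl fun lam _ => Finset.sum_congr rfl fun mu _ =>
        (hs fun d => (q ^ n * (∏ α, w α ^ d α) * E d lam mu) •
          twoSets (powerSum lam) (powerSum mu)).symm
    have h2 : ∑ lam : n.Partition, ∑ mu : n.Partition, ∑ d ∈ s,
        (q ^ n * (∏ α, w α ^ d α) * E d lam mu) • twoSets (powerSum lam) (powerSum mu) =
        ∑ k ∈ (Finset.univ : Finset n.Partition) ×ˢ (Finset.univ : Finset n.Partition) ×ˢ s,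
          (q ^ n * (∏ α, w α ^ k.2.2 α) * E k.2.2 k.1 k.2.1) •
            twoSets (powerSum k.1) (powerSum k.2.1) := by
      rw [Finset.sum_product]
      refine Finset.sum_congr rfl fun lam _ => ?_
      rw [Finset.sum_product]
    rw [h3, h2]
    refine hasSum_sum_of_ne_finset_zero ?_
    rintro ⟨lam, mu, d⟩ hk
    have hd : d ∉ s := fun h => hk (by simp [h])
    obtain ⟨α, hα⟩ : ∃ α, n < d α := by
      by_contra! hcon
      refine hd (Finset.mem_image.2 ⟨fun α => ⟨d α, Nat.lt_succ_of_le (hcon α)⟩,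
        Finset.mem_univ _, rfl⟩)
    simp only
    rw [E_eq_zero lam mu hα, mul_zero, zero_smul]
  · rintro n ⟨lam, mu, d⟩ e he
    rw [map_smul, coeff_twoSets_powerSum lam mu he, smul_zero]

/-! ### Reparametrization. -/

theorem contentProd_const_mul {n : ℕ} (lam : n.Partition) (c : ℂ) (f : ℤ → ℂ) :
    contentProd lam (fun k => c * f k) = c ^ n * contentProd lam f := by
  simp only [contentProd, Finset.prod_mul_distrib, Finset.prod_const, Finset.card_univ,
    Fintype.card_fin]
  rw [Finset.prod_pow_eq_pow_sum]
  congr 2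
  rw [← List.sum_ofFn, List.ofFn_get, sum_rows]

/-- Each box factor is `u - c = u (1 - c / u)`, and the `n` boxes collect `u ^ n`, absorbed into `q
^ n`. -/
theorem rCoeff_eq_rTilde {m n : ℕ} (s : ℂ) {u : Fin m → ℂ} (hu : ∀ α, u α ≠ 0)
    (lam : n.Partition) :
    rCoeff s u lam = rTilde (s * ∏ α, u α) (fun α => -1 / u α) lam := by
  have h1 : ∀ α, (contentProd lam fun c => u α - (c : ℂ)) =
      u α ^ n * contentProd lam fun c => 1 + -1 / u α * (c : ℂ) := by
    intro α
    rw [← contentProd_const_mul]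
    congr 1
    funext c
    have := hu α
    field_simp
    ring
  rw [rCoeff, rTilde, mul_pow, Finset.prod_congr rfl fun α _ => h1 α, Finset.prod_mul_distrib,
    Finset.prod_pow, mul_assoc]

end Multimonotone

end

theorem mainTheorem4 (m : ℕ) :
    (∀ (s : ℂ) (u : Fin m → ℂ), (∀ α, u α ≠ 0) →
      HasSum (fun l : (Σ n : ℕ, n.Partition) => Multimonotone.rCoeff s u l.2 •
          Multimonotone.twoSets (Multimonotone.schur l.2) (Multimonotone.schur l.2))
        (Multimonotone.Z s u) ∧
      (∀ (n : ℕ) (lam : n.Partition), Multimonotone.rCoeff s u lam =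
        Multimonotone.rTilde (s * ∏ α, u α) (fun α => -1 / u α) lam) ∧
      Multimonotone.Z s u = Multimonotone.ZTilde (s * ∏ α, u α) (fun α => -1 / u α)) ∧
    (∀ (q : ℂ) (w : Fin m → ℂ),
      HasSum (fun l : (Σ n : ℕ, n.Partition) => Multimonotone.rTilde q w l.2 •
          Multimonotone.twoSets (Multimonotone.schur l.2) (Multimonotone.schur l.2))
        (Multimonotone.ZTilde q w) ∧
      HasSum (fun k : (Σ n : ℕ, n.Partition × n.Partition × (Fin m → ℕ)) =>
          (q ^ k.1 * (∏ α, w α ^ k.2.2.2 α) * Multimonotone.E k.2.2.2 k.2.1 k.2.2.1) •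
            Multimonotone.twoSets (Multimonotone.powerSum k.2.1)
              (Multimonotone.powerSum k.2.2.1))
        (Multimonotone.ZTilde q w) ∧
      (∀ (n : ℕ) (lam : n.Partition),
        (q ^ n • (List.ofFn fun α => Multimonotone.elemJM n (w α)).prod) * Multimonotone.idem lam =
          Multimonotone.rTilde q w lam • Multimonotone.idem lam)) ∧
    (∀ n : ℕ,
      (∀ lam : n.Partition, Multimonotone.idem lam ≠ 0 ∧
        Multimonotone.idem lam ∈ Subalgebra.center ℂ (Multimonotone.GroupAlg n)) ∧
      (∀ lam nu : n.Partition, Multimonotone.idem lam * Multimonotone.idem nu =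
        if lam = nu then Multimonotone.idem lam else 0) ∧
      ∑ lam : n.Partition, Multimonotone.idem lam = 1) := by
  refine ⟨fun s u hu => ?_, fun q w => ⟨Multimonotone.hasSum_ZTilde q w,
    Multimonotone.hasSum_paths q w, fun n lam => ?_⟩, fun n => ⟨fun lam =>
      ⟨Multimonotone.idem_ne_zero lam, Multimonotone.idem_mem_center lam⟩,
      Multimonotone.idem_mul_idem, Multimonotone.sum_idem n⟩⟩
  · have h1 : (fun l : (Σ n : ℕ, n.Partition) => Multimonotone.rCoeff s u l.2 •
          Multimonotone.twoSets (Multimonotone.schur l.2) (Multimonotone.schur l.2)) =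
        fun l : (Σ n : ℕ, n.Partition) =>
          Multimonotone.rTilde (s * ∏ α, u α) (fun α => -1 / u α) l.2 •
          Multimonotone.twoSets (Multimonotone.schur l.2) (Multimonotone.schur l.2) := by
      funext l
      rw [Multimonotone.rCoeff_eq_rTilde s hu]
    have h2 : Multimonotone.Z s u =
        Multimonotone.ZTilde (s * ∏ α, u α) (fun α => -1 / u α) := by
      rw [Multimonotone.Z, Multimonotone.ZTilde, h1]
    refine ⟨?_, fun n lam => Multimonotone.rCoeff_eq_rTilde s hu lam, h2⟩
    rw [h1, h2]
    exact Multimonotone.hasSum_ZTilde _ _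
  · rw [smul_mul_assoc, Multimonotone.prod_elemJM_mul_idem, smul_smul]
    rfl
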